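/- **Setting (latent contextual bandit).** Let $\mathcal A=[K]$ be the finite set of actions, $\mathcal X$ the measurable space of contexts, $\mathcal S$ a finite non-empty set of latent states and $\Theta$ a (standard Borel) space of model parameters. For every $(a,x,s,\theta)$ let $P(\cdot\mid a,x,s,\theta)$ be a reward distribution on $\mathbb R$ (measurable in $(a,x,s,\theta)$), with mean $\mu(a,x,s,\theta)$. Assume: 1. rewards are $\sigma^2$-sub-Gaussian: $\mathbb E_{R\sim P(\cdot\mid a,x,s,\theta)}\big[e^{\lambda(R-\mu(a,x,s,\theta))}\big]\le e^{\sigma^2\lambda^2/2}$ for all $\lambda\in\mathbb R$ and all $a,x,s,\theta$; 2. the suboptimality of any action is at most $1$: $\mu(a',x,s,\theta)-\mu(a,x,s,\theta)\le 1$ for all $a,a',x,s,\theta$; 3. mean rewards are normalized so that changing the state and the model changes the mean reward of a fixed action in a fixed context by at most $1$: $|\mu(a,x,s,\theta)-\mu(a,x,s',\theta')|\le 1$ for all $a,x,s,s',\theta,\theta'$ (2 and 3 both hold for instance if all mean rewards lie in $[0,1]$). **Interaction.** Let $P_1$ be a probability distribution on $\mathcal S\times\Theta$ (for instance a product of a prior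 on states and a prior on models), and draw the true state and model $(S_*,\theta_*)\sim P_1$. In round $t=1,\dots,n$ a context $X_t$ is generated by an arbitrary process, i.e. from an arbitrary conditional distribution given the history $H_t=(X_1,A_1,R_1,\dots,X_{t-1},A_{t-1},R_{t-1})$; the agent chooses $A_t\in\mathcal A$; and the reward $R_t\sim P(\cdot\mid A_t,X_t,S_*,\theta_*)$ is observed. The algorithm mmTS samples $(B_t,\hat\theta_t)$ from the joint posterior, that is, from the conditional distribution of $(S_*,\theta_*)$ given $H_t$ (independently of $X_t$ and of $(S_*,\theta_*)$ given $H_t$), and plays $A_t=\arg\max_{a\in\mathcal A}\mu(a,X_t,B_t,\hat\theta_t)$, where ties in $\arg\max_a\mu(a,x,s,\theta)$ are broken by a fixed, arbitrary measurable rule. Its $n$-round Bayes regret is $$\mathcal{BR}(n)=\mathbb E\Big[\sum_{t=1}^n\mu(A_{t,*},X_t,S_*,\theta_*)-\mu(A_t,X_t,S_*,\theta_*)\Big],\qquad A_{t,*}=\arg\max_{a\in\mathcal A}\mu(a,X_t,S_*,\theta_*).$$ **Statement.** Let $\bar\mu(a,x,s)=\int\mu(a,x,s,\theta)\,P_1(d\theta)$,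 where $P_1(d\theta)$ is the $\theta$-marginal of $P_1$, and let $\varepsilon,\delta>0$ be such that, for $\theta_*\sim P_1$, $$\mathbb P\big(\forall a\in\mathcal A,\,x\in\mathcal X,\,s\in\mathcal S:\ |\bar\mu(a,x,s)-\mu(a,x,s,\theta_*)|\le\varepsilon\big)\ \ge\ 1-\delta .$$ Then for every $n$ the $n$-round regret of mmTS is integrable and $$\mathcal{BR}(n)\ \le\ n\delta+3|\mathcal S|+2n\varepsilon+2\sigma\sqrt{6|\mathcal S|\,n\log n}.$$ -/

import Mathlib

open MeasureTheory ProbabilityTheory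
open scoped NNReal

namespace LatentBandit

/-- What the agent has observed before round `t` (rounds are numbered from `0`): the contexts,
the actions it took and the rewards it received, `(X_0, A_0, R_0), …, (X_{t-1}, A_{t-1}, R_{t-1})`. -/
abbrev History (K : ℕ) (X : Type*) (t : ℕ) : Type _ := Fin t → X × Fin K × ℝ

/-- Appends the observation of round `t` to the history. -/
def History.extend {K : ℕ} {X : Type*} {t : ℕ} (h : History K X t) (o : X × Fin K × ℝ) :
    History K X (t + 1) :=
  Fin.snoc (α := fun _ => X × Fin K × ℝ) h o

theorem History.measurable_extend {K : ℕ} {X : Type*} [MeasurableSpace X] {t : ℕ} :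
    Measurable (fun p : History K X t × (X × Fin K × ℝ) => p.1.extend p.2) := by
  refine measurable_pi_lambda _ fun i => ?_
  refine Fin.lastCases ?_ (fun j => ?_) i
  · simpa [History.extend] using measurable_snd
  · simp only [History.extend, Fin.snoc_castSucc]
    exact (measurable_pi_apply j).comp measurable_fst

variable {K : ℕ} {X S Θ : Type*} [MeasurableSpace X] [MeasurableSpace S] [MeasurableSpace Θ]

/-- The mean reward `μ(a, x, s, θ)` of the conditional reward distribution `P(· | a, x, s, θ)`. -/
noncomputable def meanReward (P : Kernel (Fin K × X × S × Θ) ℝ)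
    (a : Fin K) (x : X) (s : S) (θ : Θ) : ℝ :=
  ∫ r, r ∂(P (a, x, s, θ))

/-- The mean reward marginalized over the prior of the model parameter,
`∫ μ(a, x, s, θ) dP₁(θ)`, where `P₁(dθ)` is the `θ`-marginal of the joint prior. -/
noncomputable def marginalMean (P : Kernel (Fin K × X × S × Θ) ℝ) (prior : Measure (S × Θ))
    (a : Fin K) (x : X) (s : S) : ℝ :=
  ∫ θ, meanReward P a x s θ ∂prior.snd

/-- `act x s θ` is an optimal action `argmax_a μ(a, x, s, θ)` (the ties being broken by `act`). -/
def IsArgmax (P : Kernel (Fin K × X × S × Θ) ℝ) (act : X → S → Θ → Fin K) : Prop :=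
  ∀ x s θ a, meanReward P a x s θ ≤ meanReward P (act x s θ) x s θ

/-- The law of the choice `(X_t, A_t)` in one round given the history: the context is drawn from
`ctx`, a state and a model `(B_t, θ̂_t)` are drawn from `post`, independently of the context, and
the action is the one that is optimal for the sampled state and model. -/
noncomputable def choiceKernel {t : ℕ} (ctx : Kernel (History K X t) X)
    (post : Kernel (History K X t) (S × Θ)) (act : X → S → Θ → Fin K) :
    Kernel (History K X t) (X × Fin K) :=
  (ctx ×ₖ post).map fun p => (p.1, act p.1 p.2.1 p.2.2)

/-- The law of the observation `(X_t, A_t, R_t)` of one round given the true state and model and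
the history: the choice depends on the history only, and the reward is then drawn from
`P(· | A_t, X_t, S_*, θ_*)`. -/
noncomputable def roundKernel {t : ℕ} (P : Kernel (Fin K × X × S × Θ) ℝ)
    (choice : Kernel (History K X t) (X × Fin K)) :
    Kernel ((S × Θ) × History K X t) (X × Fin K × ℝ) :=
  ((choice.comap Prod.snd measurable_snd) ⊗ₖ
    (P.comap (fun p : ((S × Θ) × History K X t) × (X × Fin K) =>
      (p.2.2, p.2.1, p.1.1.1, p.1.1.2)) (by fun_prop))).map
    fun q => (q.1.1, q.1.2, q.2)

theorem isMarkovKernel_roundKernel {t : ℕ} (P : Kernel (Fin K × X × S × Θ) ℝ) [IsMarkovKernel P]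
    (ctx : Kernel (History K X t) X) [IsMarkovKernel ctx]
    (post : Kernel (History K X t) (S × Θ)) [IsMarkovKernel post]
    (act : X → S → Θ → Fin K) (hact : Measurable fun p : X × S × Θ => act p.1 p.2.1 p.2.2) :
    IsMarkovKernel (roundKernel P (choiceKernel ctx post act)) := by
  have h1 : IsMarkovKernel (choiceKernel ctx post act) :=
    Kernel.IsMarkovKernel.map _ (measurable_fst.prodMk hact)
  exact Kernel.IsMarkovKernel.map _ (by fun_prop)

section Interaction

variable [StandardBorelSpace S] [StandardBorelSpace Θ] [Nonempty S] [Nonempty Θ]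

/-- The joint posterior: the conditional distribution of `(S_*, θ_*)` given the history, under a
joint law of `(S_*, θ_*)` and the history. -/
noncomputable def posterior {t : ℕ} (law : ProbabilityMeasure ((S × Θ) × History K X t)) :
    Kernel (History K X t) (S × Θ) :=
  condDistrib Prod.fst Prod.snd (law : Measure ((S × Θ) × History K X t))

/-- The joint law of the true state and model `(S_*, θ_*)` and of the history of the first `t`
rounds when the agent runs `mmTS`. The pair `(S_*, θ_*)` is drawn from the prior. In each round
the context is drawn given the history, `(B_t, θ̂_t)` is drawn from the posterior of `(S_*, θ_*)`
given the history, the action maximizes the mean reward under `(B_t, θ̂_t)`, and the reward is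
drawn from `P(· | A_t, X_t, S_*, θ_*)`. -/
noncomputable def mmTSLaw (P : Kernel (Fin K × X × S × Θ) ℝ) [IsMarkovKernel P]
    (prior : Measure (S × Θ)) [IsProbabilityMeasure prior]
    (ctx : ∀ t, Kernel (History K X t) X) [∀ t, IsMarkovKernel (ctx t)]
    (act : X → S → Θ → Fin K) (hact : Measurable fun p : X × S × Θ => act p.1 p.2.1 p.2.2) :
    ∀ t, ProbabilityMeasure ((S × Θ) × History K X t)
  | 0 => ⟨prior.map fun w => (w, fun i => i.elim0),
      Measure.isProbabilityMeasure_map (by fun_prop)⟩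
  | t + 1 =>
    let law := mmTSLaw P prior ctx act hact t
    ⟨((law : Measure ((S × Θ) × History K X t)) ⊗ₘ
        roundKernel P (choiceKernel (ctx t) (posterior law) act)).map
        fun p => (p.1.1, p.1.2.extend p.2), by
      have : IsMarkovKernel (posterior law) := by unfold posterior; infer_instance
      have := isMarkovKernel_roundKernel P (ctx t) (posterior law) act hact
      refine Measure.isProbabilityMeasure_map (Measurable.aemeasurable ?_)
      exact (measurable_fst.comp measurable_fst).prodMk (History.measurable_extend.comp
        ((measurable_snd.comp measurable_fst).prodMk measurable_snd))⟩

end Interaction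

/-- The realized `n`-round regret
`∑_t (μ(A_{t,*}, X_t, S_*, θ_*) - μ(A_t, X_t, S_*, θ_*))` with `A_{t,*} = act X_t S_* θ_*`,
as a function of `(S_*, θ_*)` and the history of `n` rounds. -/
noncomputable def regret (P : Kernel (Fin K × X × S × Θ) ℝ) (act : X → S → Θ → Fin K) (n : ℕ)
    (ω : (S × Θ) × History K X n) : ℝ :=
  ∑ t : Fin n,
    (meanReward P (act (ω.2 t).1 ω.1.1 ω.1.2) (ω.2 t).1 ω.1.1 ω.1.2 -
      meanReward P (ω.2 t).2.1 (ω.2 t).1 ω.1.1 ω.1.2)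

/-- The `n`-round Bayes regret of `mmTS`. -/
noncomputable def bayesRegret [StandardBorelSpace S] [StandardBorelSpace Θ]
    [Nonempty S] [Nonempty Θ]
    (P : Kernel (Fin K × X × S × Θ) ℝ) [IsMarkovKernel P]
    (prior : Measure (S × Θ)) [IsProbabilityMeasure prior]
    (ctx : ∀ t, Kernel (History K X t) X) [∀ t, IsMarkovKernel (ctx t)]
    (act : X → S → Θ → Fin K) (hact : Measurable fun p : X × S × Θ => act p.1 p.2.1 p.2.2)
    (n : ℕ) : ℝ :=
  ∫ ω, regret P act n ω ∂(mmTSLaw P prior ctx act hact n : Measure ((S × Θ) × History K X n))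

end LatentBandit

/-!
Given the history, the truth `(S_*, θ_*)` and the posterior sample `(B_t, θ̂_t)` are
exchangeable, so the expected regret of a round equals the expected amount by which the sample
overestimates the mean reward of the action it leads to. On the event `θ̂_t ∈ G` that the
sampled model is close to the marginal means, the overestimate is at most `ε` plus the gap
`μ̄(A_t, X_t, B_t) - μ(A_t, X_t, S_*, θ_*)`; off this event it is at most `1`, and by
exchangeability the event fails with probability at most `δ`.

For a state `s`, replacing the indicator of `B_t = s, θ̂_t ∈ G` by its conditional probability
given the history, the context and the action turns the sum of the gaps into a sum with
predictable weights in `[0, 1]`. The agent can compute the score, the weighted sum of `μ̄(A_t,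
X_t, s) - R_t`; it differs from the gaps by a weighted sum of sub-Gaussian noise, which is
controlled by an exponential supermartingale. As long as the score is small, so are the
accumulated gaps. If the score ever becomes large, then `s` together with a model in `G` is
unlikely to be the truth, and hence, by exchangeability once more, unlikely to be sampled. Since
the weights of all states sum to at most `1` in each round, a single parameter of the
supermartingale serves all states, and optimizing over it gives the square root.
-/

namespace LatentBandit

section Histories

variable {K : ℕ} {X : Type*}

/-- The history at the earlier round `m`. -/
def History.take {m n : ℕ} (hmn : m ≤ n) (h : History K X n) : History K X m :=
  fun i => h (Fin.castLE hmn i)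

theorem History.take_extend {t : ℕ} (h : History K X t) (o : X × Fin K × ℝ) :
    (h.extend o).take t.le_succ = h :=
  Fin.init_snoc _ _

theorem History.extend_last {t : ℕ} (h : History K X t) (o : X × Fin K × ℝ) :
    h.extend o (Fin.last t) = o :=
  Fin.snoc_last _ _

/-- The sum over the rounds of a function of the past and of the observation of the round. -/
def cumulative (f : ∀ t, History K X t → X × Fin K × ℝ → ℝ) (n : ℕ) (h : History K X n) : ℝ :=
  ∑ t : Fin n, f t (h.take t.2.le) (h t)

theorem cumulative_succ (f : ∀ t, History K X t → X × Fin K × ℝ → ℝ) {n : ℕ}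
    (h : History K X (n + 1)) :
    cumulative f (n + 1) h =
      cumulative f n (h.take n.le_succ) + f n (h.take n.le_succ) (h (Fin.last n)) :=
  Fin.sum_univ_castSucc _

theorem cumulative_extend (f : ∀ t, History K X t → X × Fin K × ℝ → ℝ) {n : ℕ}
    (h : History K X n) (o : X × Fin K × ℝ) :
    cumulative f (n + 1) (h.extend o) = cumulative f n h + f n h o := by
  rw [cumulative_succ, History.take_extend, History.extend_last]

variable [MeasurableSpace X] {Ω : Type*} [MeasurableSpace Ω]

@[fun_prop]
theorem History.measurable_take {m n : ℕ} (hmn : m ≤ n) {h : Ω → History K X n}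
    (hh : Measurable h) : Measurable fun ω => (h ω).take hmn :=
  measurable_pi_lambda _ fun i => (measurable_pi_apply (Fin.castLE hmn i)).comp hh

@[fun_prop]
theorem History.measurable_extend_comp {t : ℕ} {h : Ω → History K X t} {o : Ω → X × Fin K × ℝ}
    (hh : Measurable h) (ho : Measurable o) : Measurable fun ω => (h ω).extend (o ω) :=
  History.measurable_extend.comp (hh.prodMk ho)

theorem measurable_cumulative {f : Ω → ∀ t, History K X t → X × Fin K × ℝ → ℝ}
    (hf : ∀ t, Measurable fun p : Ω × History K X t × X × Fin K × ℝ => f p.1 t p.2.1 p.2.2)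
    {n : ℕ} {h : Ω → History K X n} (hh : Measurable h) :
    Measurable fun ω => cumulative (f ω) n (h ω) :=
  Finset.measurable_sum _ fun t _ => (hf t).comp (by fun_prop :
    Measurable fun ω => (ω, (h ω).take t.2.le, h ω t))

end Histories

section MeanRewards

variable {K : ℕ} {X S Θ : Type*} [MeasurableSpace X] [MeasurableSpace S] [MeasurableSpace Θ]

@[fun_prop]
theorem measurable_meanReward {Ω : Type*} [MeasurableSpace Ω]
    (P : Kernel (Fin K × X × S × Θ) ℝ) {a : Ω → Fin K} {x : Ω → X} {s : Ω → S}
    {θ : Ω → Θ} (ha : Measurable a) (hx : Measurable x) (hs : Measurable s) (hθ : Measurable θ) :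
    Measurable fun ω => meanReward P (a ω) (x ω) (s ω) (θ ω) :=
  (StronglyMeasurable.integral_kernel (κ := P) (f := fun r : ℝ => r)
    measurable_id.stronglyMeasurable).measurable.comp (ha.prodMk (hx.prodMk (hs.prodMk hθ)))

theorem measurable_marginalMean (P : Kernel (Fin K × X × S × Θ) ℝ)
    (prior : Measure (S × Θ)) [IsProbabilityMeasure prior] :
    Measurable fun p : Fin K × X × S => marginalMean P prior p.1 p.2.1 p.2.2 :=
  (by fun_prop : Measurable fun q : (Fin K × X × S) × Θ =>
    meanReward P q.1.1 q.1.2.1 q.1.2.2 q.2).stronglyMeasurable.integral_prod_right'.measurable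

end MeanRewards

section PosteriorSampling

variable {K : ℕ} {X S Θ : Type*} [MeasurableSpace X] [MeasurableSpace S] [MeasurableSpace Θ]
  [StandardBorelSpace S] [StandardBorelSpace Θ] [Nonempty S] [Nonempty Θ]

/-- The state of round `t` just before its reward is observed: `((w, h), x, w')` collects the true
state and model `w`, the history `h`, the context `x` and the posterior sample `w'`. -/
abbrev Draw (K : ℕ) (X S Θ : Type*) (t : ℕ) : Type _ :=
  ((S × Θ) × History K X t) × X × S × Θ

/-- Swaps the true state and model with the posterior sample. -/
def Draw.exchange {K : ℕ} {X S Θ : Type*} {t : ℕ} (q : Draw K X S Θ t) : Draw K X S Θ t :=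
  ((q.2.2, q.1.2), q.2.1, q.1.1)

instance {t : ℕ} (law : ProbabilityMeasure ((S × Θ) × History K X t)) :
    IsMarkovKernel (posterior law) :=
  inferInstanceAs (IsMarkovKernel (condDistrib _ _ _))

/-- The law of the draw of round `t` under mmTS, given the joint law of the true state and model
and of the history. -/
noncomputable def sampleLaw {t : ℕ} (law : ProbabilityMeasure ((S × Θ) × History K X t))
    (ctx : Kernel (History K X t) X) : Measure (Draw K X S Θ t) :=
  (law : Measure ((S × Θ) × History K X t)) ⊗ₘ
    ((ctx ×ₖ posterior law).comap Prod.snd measurable_snd)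

variable {t : ℕ} (law : ProbabilityMeasure ((S × Θ) × History K X t))
  (ctx : Kernel (History K X t) X) [IsMarkovKernel ctx]

instance : IsProbabilityMeasure (sampleLaw law ctx) :=
  inferInstanceAs (IsProbabilityMeasure (_ ⊗ₘ _))

theorem measurePreserving_fst_sampleLaw :
    MeasurePreserving Prod.fst (sampleLaw law ctx)
      (law : Measure ((S × Θ) × History K X t)) :=
  ⟨measurable_fst, Measure.fst_compProd _ _⟩

theorem lintegral_eq_lintegral_posterior {f : (S × Θ) × History K X t → ENNReal}
    (hf : Measurable f) :
    ∫⁻ p, f p ∂(law : Measure ((S × Θ) × History K X t)) =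
      ∫⁻ h, ∫⁻ w, f (w, h) ∂posterior law h
        ∂(law : Measure ((S × Θ) × History K X t)).map Prod.snd := by
  have hdis := compProd_map_condDistrib (mβ := MeasurableSpace.pi)
    (X := (Prod.snd : (S × Θ) × History K X t → History K X t)) (Y := Prod.fst)
    (μ := (law : Measure ((S × Θ) × History K X t))) (by fun_prop)
  rw [← Measure.lintegral_compProd (f := fun q => f (q.2, q.1)) (by fun_prop), posterior, hdis,
    lintegral_map (by fun_prop) (by fun_prop)]

theorem lintegral_sampleLaw {f : Draw K X S Θ t → ENNReal} (hf : Measurable f) :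
    ∫⁻ q, f q ∂sampleLaw law ctx =
      ∫⁻ h, ∫⁻ x, ∫⁻ w, ∫⁻ w', f ((w, h), x, w') ∂posterior law h ∂posterior law h ∂ctx h
        ∂(law : Measure ((S × Θ) × History K X t)).map Prod.snd := by
  rw [sampleLaw, Measure.lintegral_compProd hf,
    lintegral_eq_lintegral_posterior law hf.lintegral_kernel_prod_right']
  refine lintegral_congr fun h => ?_
  have hinner : Measurable fun z : (S × Θ) × X =>
      ∫⁻ w', f ((z.1, h), z.2, w') ∂posterior law h :=
    Measurable.lintegral_prod_right' (f := fun y : ((S × Θ) × X) × S × Θ =>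
      f ((y.1.1, h), y.1.2, y.2)) (by fun_prop)
  have hprod (w : S × Θ) :
      ∫⁻ y, f ((w, h), y) ∂(ctx ×ₖ posterior law) h =
        ∫⁻ x, ∫⁻ w', f ((w, h), x, w') ∂posterior law h ∂ctx h :=
    Kernel.lintegral_prod _ _ _ (by fun_prop)
  simp_rw [Kernel.comap_apply, hprod]
  exact lintegral_lintegral_swap (f := fun w x => ∫⁻ w', f ((w, h), x, w') ∂posterior law h)
    hinner.aemeasurable

/-- Thompson sampling: given the history, the truth and the posterior sample are independent with
the same law. -/
theorem measurePreserving_exchange :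
    MeasurePreserving Draw.exchange (sampleLaw law ctx) (sampleLaw law ctx) := by
  have hex : Measurable (Draw.exchange : Draw K X S Θ t → Draw K X S Θ t) := by
    unfold Draw.exchange; fun_prop
  refine ⟨hex, Measure.ext_of_lintegral _ fun f hf => ?_⟩
  rw [lintegral_map hf hex, lintegral_sampleLaw law ctx hf,
    lintegral_sampleLaw law ctx (f := fun q => f q.exchange) (hf.comp hex)]
  refine lintegral_congr fun h => lintegral_congr fun x => ?_
  exact lintegral_lintegral_swap (f := fun w w' => f ((w', h), x, w)) (by fun_prop)

theorem measurePreserving_sample :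
    MeasurePreserving (fun q : Draw K X S Θ t => (q.2.2, q.1.2)) (sampleLaw law ctx)
      (law : Measure ((S × Θ) × History K X t)) :=
  (measurePreserving_fst_sampleLaw law ctx).comp (measurePreserving_exchange law ctx)

theorem integral_eq_zero_of_exchange_eq_neg {f : Draw K X S Θ t → ℝ} (hf : Measurable f)
    (hneg : ∀ q, f q.exchange = -f q) : ∫ q, f q ∂sampleLaw law ctx = 0 := by
  have hself : ∫ q, f q ∂sampleLaw law ctx = -∫ q, f q ∂sampleLaw law ctx := by
    conv_lhs => rw [← (measurePreserving_exchange law ctx).map_eq]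
    rw [integral_map (measurePreserving_exchange law ctx).measurable.aemeasurable
      hf.aestronglyMeasurable]
    simp_rw [hneg, integral_neg]
  linarith

end PosteriorSampling

section Interaction

variable {K : ℕ} {X S Θ : Type*} [MeasurableSpace X] [MeasurableSpace S] [MeasurableSpace Θ]

/-- The action taken by `mmTS` in a draw. -/
def Draw.action (act : X → S → Θ → Fin K) {t : ℕ} (q : Draw K X S Θ t) : Fin K :=
  act q.2.1 q.2.2.1 q.2.2.2

/-- The part of a draw that precedes the reward and is recorded: the true state and model, the
history, the context and the action. -/
def Draw.choice (act : X → S → Θ → Fin K) {t : ℕ} (q : Draw K X S Θ t) :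
    (S × Θ) × History K X t × X × Fin K :=
  (q.1.1, q.1.2, q.2.1, q.action act)

@[fun_prop]
theorem Draw.measurable_action {act : X → S → Θ → Fin K}
    (hact : Measurable fun p : X × S × Θ => act p.1 p.2.1 p.2.2) {t : ℕ} :
    Measurable (Draw.action act : Draw K X S Θ t → Fin K) :=
  hact.comp measurable_snd

theorem Draw.measurable_choice {act : X → S → Θ → Fin K}
    (hact : Measurable fun p : X × S × Θ => act p.1 p.2.1 p.2.2) {t : ℕ} :
    Measurable (Draw.choice act : Draw K X S Θ t → _) := by
  have := Draw.measurable_action hact (t := t)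
  unfold Draw.choice
  fun_prop

theorem lintegral_roundKernel (P : Kernel (Fin K × X × S × Θ) ℝ) [IsMarkovKernel P] {t : ℕ}
    (ctx : Kernel (History K X t) X) [IsMarkovKernel ctx]
    (post : Kernel (History K X t) (S × Θ)) [IsMarkovKernel post]
    {act : X → S → Θ → Fin K} (hact : Measurable fun p : X × S × Θ => act p.1 p.2.1 p.2.2)
    (p : (S × Θ) × History K X t) {f : X × Fin K × ℝ → ENNReal} (hf : Measurable f) :
    ∫⁻ o, f o ∂roundKernel P (choiceKernel ctx post act) p =
      ∫⁻ y, ∫⁻ r, f (y.1, act y.1 y.2.1 y.2.2, r) ∂P (act y.1 y.2.1 y.2.2, y.1, p.1.1, p.1.2)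
        ∂(ctx ×ₖ post) p.2 := by
  have hact' : Measurable fun y : X × S × Θ => (y.1, act y.1 y.2.1 y.2.2) :=
    measurable_fst.prodMk hact
  have : IsMarkovKernel (choiceKernel ctx post act) := Kernel.IsMarkovKernel.map _ hact'
  have hf' : Measurable fun q : (X × Fin K) × ℝ => f (q.1.1, q.1.2, q.2) := by fun_prop
  rw [roundKernel, Kernel.lintegral_map _ (by fun_prop) _ hf, Kernel.lintegral_compProd _ _ _ hf',
    Kernel.comap_apply, choiceKernel, Kernel.lintegral_map _ hact']
  · rfl
  · exact Measurable.lintegral_kernel_prod_right' (κ := P.comap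
      (fun y : X × Fin K => (y.2, y.1, p.1.1, p.1.2)) (by fun_prop)) hf'

variable [StandardBorelSpace S] [StandardBorelSpace Θ] [Nonempty S] [Nonempty Θ]
  (P : Kernel (Fin K × X × S × Θ) ℝ) [IsMarkovKernel P]
  (prior : Measure (S × Θ)) [IsProbabilityMeasure prior]
  (ctx : ∀ t, Kernel (History K X t) X) [∀ t, IsMarkovKernel (ctx t)]
  (act : X → S → Θ → Fin K) (hact : Measurable fun p : X × S × Θ => act p.1 p.2.1 p.2.2)

theorem lintegral_mmTSLaw_succ (t : ℕ) {f : (S × Θ) × History K X (t + 1) → ENNReal}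
    (hf : Measurable f) :
    ∫⁻ p, f p ∂(mmTSLaw P prior ctx act hact (t + 1) : Measure _) =
      ∫⁻ q, ∫⁻ r, f (q.1.1, q.1.2.extend (q.2.1, q.action act, r))
          ∂P (q.action act, q.2.1, q.1.1.1, q.1.1.2)
        ∂sampleLaw (mmTSLaw P prior ctx act hact t) (ctx t) := by
  set law := mmTSLaw P prior ctx act hact t
  have := isMarkovKernel_roundKernel P (ctx t) (posterior law) act hact
  have hsucc : (mmTSLaw P prior ctx act hact (t + 1) : Measure ((S × Θ) × History K X (t + 1))) =
      ((law : Measure ((S × Θ) × History K X t)) ⊗ₘ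
        roundKernel P (choiceKernel (ctx t) (posterior law) act)).map
          fun p => (p.1.1, p.1.2.extend p.2) := rfl
  have := Draw.measurable_action hact (t := t)
  have hreward : Measurable fun q : Draw K X S Θ t =>
      ∫⁻ r, f (q.1.1, q.1.2.extend (q.2.1, q.action act, r))
        ∂P (q.action act, q.2.1, q.1.1.1, q.1.1.2) :=
    Measurable.lintegral_kernel_prod_right' (κ := P.comap
      (fun q : Draw K X S Θ t => (q.action act, q.2.1, q.1.1.1, q.1.1.2)) (by fun_prop))
      (f := fun z : Draw K X S Θ t × ℝ =>
        f (z.1.1.1, z.1.1.2.extend (z.1.2.1, z.1.action act, z.2))) (by fun_prop)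
  rw [hsucc, lintegral_map hf (by fun_prop), Measure.lintegral_compProd (by fun_prop), sampleLaw,
    Measure.lintegral_compProd hreward]
  refine lintegral_congr fun p => ?_
  rw [lintegral_roundKernel P (ctx t) _ hact p (f := fun o => f (p.1, p.2.extend o))
    (by fun_prop), Kernel.comap_apply]
  rfl

theorem map_mmTSLaw_succ {t : ℕ} {β : Type*} [MeasurableSpace β]
    {F : (S × Θ) × History K X (t + 1) → β} (hF : Measurable F)
    {G : (S × Θ) × History K X t × X × Fin K → β} (hG : Measurable G)
    (hFG : ∀ w h x a r, F (w, History.extend h (x, a, r)) = G (w, h, x, a)) :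
    (mmTSLaw P prior ctx act hact (t + 1) : Measure _).map F =
      (sampleLaw (mmTSLaw P prior ctx act hact t) (ctx t)).map (G ∘ Draw.choice act) := by
  refine Measure.ext_of_lintegral _ fun f hf => ?_
  rw [lintegral_map hf hF, lintegral_map hf (hG.comp (Draw.measurable_choice hact)),
    lintegral_mmTSLaw_succ P prior ctx act hact t (f := fun p => f (F p)) (hf.comp hF)]
  refine lintegral_congr fun q => ?_
  simp only [hFG, lintegral_const, measure_univ, mul_one, Function.comp_apply, Draw.choice]

theorem measurePreserving_take {m n : ℕ} (hmn : m ≤ n) :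
    MeasurePreserving (fun p : (S × Θ) × History K X n => (p.1, p.2.take hmn))
      (mmTSLaw P prior ctx act hact n : Measure _)
      (mmTSLaw P prior ctx act hact m : Measure _) := by
  induction n, hmn using Nat.le_induction with
  | base => exact MeasurePreserving.id _
  | succ n hmn ih =>
    have hstep : MeasurePreserving
        (fun p : (S × Θ) × History K X (n + 1) => (p.1, p.2.take n.le_succ))
        (mmTSLaw P prior ctx act hact (n + 1) : Measure _)
        (mmTSLaw P prior ctx act hact n : Measure _) := by
      refine ⟨by fun_prop, ?_⟩
      rw [map_mmTSLaw_succ P prior ctx act hact (G := fun y => (y.1, y.2.1)) (by fun_prop)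
        (by fun_prop) fun w h x a r => by rw [History.take_extend]]
      exact (measurePreserving_fst_sampleLaw _ _).map_eq
    exact ih.comp hstep

theorem map_fst_mmTSLaw (n : ℕ) :
    (mmTSLaw P prior ctx act hact n : Measure ((S × Θ) × History K X n)).map Prod.fst = prior := by
  have h0 : (mmTSLaw P prior ctx act hact 0 : Measure ((S × Θ) × History K X 0)).map Prod.fst =
      prior := by
    change (prior.map _).map _ = _
    rw [Measure.map_map measurable_fst (by fun_prop)]
    exact Measure.map_id
  rw [← (measurePreserving_take P prior ctx act hact n.zero_le).map_eq,
    Measure.map_map measurable_fst (by fun_prop)] at h0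
  exact h0

theorem map_choice_mmTSLaw {n : ℕ} (t : Fin n) :
    (mmTSLaw P prior ctx act hact n : Measure ((S × Θ) × History K X n)).map
        (fun p => (p.1, p.2.take t.2.le, (p.2 t).1, (p.2 t).2.1)) =
      (sampleLaw (mmTSLaw P prior ctx act hact t) (ctx t)).map (Draw.choice act) := by
  have hround := map_mmTSLaw_succ P prior ctx act hact (t := t) (G := id)
    (F := fun p => (p.1, p.2.take t.1.le_succ, (p.2 (Fin.last t)).1, (p.2 (Fin.last t)).2.1))
    (by fun_prop) measurable_id fun w h x a r => by
      simp only [History.take_extend, History.extend_last, id]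
  rw [Function.id_comp,
    ← (measurePreserving_take P prior ctx act hact (Nat.succ_le_of_lt t.2)).map_eq,
    Measure.map_map (by fun_prop) (by fun_prop)] at hround
  exact hround

section Sum

variable {g : ∀ t, (S × Θ) × History K X t × X × Fin K → ℝ} (hg : ∀ t, Measurable (g t))
  (hint : ∀ t, Integrable (fun q => g t (q.choice act))
    (sampleLaw (mmTSLaw P prior ctx act hact t) (ctx t)))

include hg hint

theorem integrable_round {n : ℕ} (t : Fin n) :
    Integrable (fun p : (S × Θ) × History K X n =>
        g t (p.1, p.2.take t.2.le, (p.2 t).1, (p.2 t).2.1))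
      (mmTSLaw P prior ctx act hact n : Measure _) := by
  have hmap := (integrable_map_measure (hg t).aestronglyMeasurable
    (Draw.measurable_choice hact).aemeasurable).2 (hint t)
  rw [← map_choice_mmTSLaw P prior ctx act hact t] at hmap
  exact (integrable_map_measure (hg t).aestronglyMeasurable
    (Measurable.aemeasurable (by fun_prop))).1 hmap

theorem integrable_cumulative (n : ℕ) :
    Integrable (fun p : (S × Θ) × History K X n =>
        cumulative (fun t h o => g t (p.1, h, o.1, o.2.1)) n p.2)
      (mmTSLaw P prior ctx act hact n : Measure _) :=
  integrable_finsetSum _ fun t _ => integrable_round P prior ctx act hact hg hint t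

theorem integral_cumulative (n : ℕ) :
    ∫ p, cumulative (fun t h o => g t (p.1, h, o.1, o.2.1)) n p.2
        ∂(mmTSLaw P prior ctx act hact n : Measure ((S × Θ) × History K X n)) =
      ∑ t : Fin n, ∫ q, g t (q.choice act)
        ∂sampleLaw (mmTSLaw P prior ctx act hact t) (ctx t) := by
  unfold cumulative
  rw [integral_finsetSum _ fun t _ => integrable_round P prior ctx act hact hg hint t]
  refine Finset.sum_congr rfl fun t _ => ?_
  rw [← integral_map (Draw.measurable_choice hact).aemeasurable (hg t).aestronglyMeasurable,
    ← map_choice_mmTSLaw P prior ctx act hact t,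
    integral_map (Measurable.aemeasurable (by fun_prop)) (hg t).aestronglyMeasurable]

end Sum

end Interaction

section Weights

variable {K : ℕ} {X S Θ : Type*} [MeasurableSpace X] [MeasurableSpace S] [MeasurableSpace Θ]

/-- The rewards are sub-Gaussian with variance proxy `σ ^ 2`. -/
def SubgaussianRewards (P : Kernel (Fin K × X × S × Θ) ℝ) (σ : ℝ≥0) : Prop :=
  ∀ a x s θ, HasSubgaussianMGF (fun r => r - meanReward P a x s θ) (σ ^ 2) (P (a, x, s, θ))

/-- A predictable process: `v t h x a` is the weight of round `t` with history `h` if the action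
`a` is taken in the context `x`. -/
abbrev WeightProcess (K : ℕ) (X : Type*) : Type _ := ∀ t, History K X t → X → Fin K → ℝ

/-- A measurable weight process with values in `[0, 1]`. -/
structure IsUnitWeight (v : WeightProcess K X) : Prop where
  measurable : ∀ t, Measurable fun p : History K X t × X × Fin K => v t p.1 p.2.1 p.2.2
  nonneg : ∀ t h x a, 0 ≤ v t h x a
  le_one : ∀ t h x a, v t h x a ≤ 1

/-- The total weight of the rounds. -/
def count (v : WeightProcess K X) (n : ℕ) (h : History K X n) : ℝ :=
  cumulative (fun t h o => v t h o.1 o.2.1) n h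

/-- The weighted sum of the differences between the predicted and the observed rewards. -/
def score (v : WeightProcess K X) (m : Fin K → X → ℝ) (n : ℕ) (h : History K X n) : ℝ :=
  cumulative (fun t h o => v t h o.1 o.2.1 * (m o.2.1 o.1 - o.2.2)) n h

/-- The weighted sum of the deviations of the rewards from their means under `w`. -/
noncomputable def noise (P : Kernel (Fin K × X × S × Θ) ℝ) (v : WeightProcess K X) (w : S × Θ)
    (n : ℕ) (h : History K X n) : ℝ :=
  cumulative (fun t h o => v t h o.1 o.2.1 * (o.2.2 - meanReward P o.2.1 o.1 w.1 w.2)) n h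

/-- The weighted sum of the differences between the predicted rewards and the mean rewards under
`w`. -/
noncomputable def excess (P : Kernel (Fin K × X × S × Θ) ℝ) (v : WeightProcess K X)
    (m : Fin K → X → ℝ) (w : S × Θ) (n : ℕ) (h : History K X n) : ℝ :=
  cumulative (fun t h o => v t h o.1 o.2.1 * (m o.2.1 o.1 - meanReward P o.2.1 o.1 w.1 w.2)) n h

/-- The exponential of the weighted noise, compensated so that it is a supermartingale for
`σ ^ 2`-sub-Gaussian rewards. -/
noncomputable def expNoise (P : Kernel (Fin K × X × S × Θ) ℝ) (v : WeightProcess K X) (σ l : ℝ)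
    (w : S × Θ) (n : ℕ) (h : History K X n) : ℝ :=
  Real.exp (l * noise P v w n h - l ^ 2 * σ ^ 2 / 2 * count v n h)

/-- The sum of `expNoise` over all rounds up to `n`, which stands in for its running maximum. -/
noncomputable def expNoiseSum (P : Kernel (Fin K × X × S × Θ) ℝ) (v : WeightProcess K X)
    (σ l : ℝ) (w : S × Θ) (n : ℕ) (h : History K X n) : ℝ :=
  ∑ j : Fin (n + 1), expNoise P v σ l w j (h.take j.is_le)

theorem score_add_noise (P : Kernel (Fin K × X × S × Θ) ℝ) (v : WeightProcess K X)
    (m : Fin K → X → ℝ) (w : S × Θ) {n : ℕ} (h : History K X n) :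
    score v m n h + noise P v w n h = excess P v m w n h := by
  simp only [score, noise, excess, cumulative, ← Finset.sum_add_distrib]
  exact Finset.sum_congr rfl fun t _ => by ring

theorem expNoise_pos (P : Kernel (Fin K × X × S × Θ) ℝ) (v : WeightProcess K X) (σ l : ℝ)
    (w : S × Θ) {n : ℕ} (h : History K X n) : 0 < expNoise P v σ l w n h :=
  Real.exp_pos _

theorem expNoise_le_expNoiseSum (P : Kernel (Fin K × X × S × Θ) ℝ) (v : WeightProcess K X)
    (σ l : ℝ) (w : S × Θ) {j n : ℕ} (hj : j ≤ n) (h : History K X n) :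
    expNoise P v σ l w j (h.take hj) ≤ expNoiseSum P v σ l w n h :=
  Finset.single_le_sum (f := fun j : Fin (n + 1) => expNoise P v σ l w j (h.take j.is_le))
    (fun _ _ => (expNoise_pos ..).le) (Finset.mem_univ ⟨j, Nat.lt_succ_of_le hj⟩)

theorem expNoiseSum_nonneg (P : Kernel (Fin K × X × S × Θ) ℝ) (v : WeightProcess K X)
    (σ l : ℝ) (w : S × Θ) {n : ℕ} (h : History K X n) : 0 ≤ expNoiseSum P v σ l w n h :=
  Finset.sum_nonneg fun _ _ => (expNoise_pos ..).le

theorem expNoiseSum_take_le (P : Kernel (Fin K × X × S × Θ) ℝ) (v : WeightProcess K X)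
    (σ l : ℝ) (w : S × Θ) {n : ℕ} (h : History K X (n + 1)) :
    expNoiseSum P v σ l w n (h.take n.le_succ) ≤ expNoiseSum P v σ l w (n + 1) h := by
  conv_rhs => rw [expNoiseSum, Fin.sum_univ_castSucc]
  exact le_add_of_nonneg_right (expNoise_pos ..).le

namespace IsUnitWeight

variable {v : WeightProcess K X} (hv : IsUnitWeight v)

include hv

theorem measurable_count (n : ℕ) : Measurable (count v n) := by
  have := hv.measurable
  exact measurable_cumulative (f := fun _ t h o => v t h o.1 o.2.1) (by fun_prop) measurable_id

theorem measurable_score {m : Fin K → X → ℝ} (hm : Measurable fun p : Fin K × X => m p.1 p.2)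
    (n : ℕ) : Measurable (score v m n) := by
  have := hv.measurable
  exact measurable_cumulative (f := fun _ t h o => v t h o.1 o.2.1 * (m o.2.1 o.1 - o.2.2))
    (by fun_prop) measurable_id

variable (P : Kernel (Fin K × X × S × Θ) ℝ)

theorem measurable_noise (n : ℕ) :
    Measurable fun p : (S × Θ) × History K X n => noise P v p.1 n p.2 := by
  have := hv.measurable
  exact measurable_cumulative (f := fun (p : (S × Θ) × History K X n) t h o =>
    v t h o.1 o.2.1 * (o.2.2 - meanReward P o.2.1 o.1 p.1.1 p.1.2)) (by fun_prop) measurable_snd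

theorem measurable_expNoise (σ l : ℝ) (n : ℕ) :
    Measurable fun p : (S × Θ) × History K X n => expNoise P v σ l p.1 n p.2 := by
  have := hv.measurable_noise P n
  have := hv.measurable_count n
  unfold expNoise
  fun_prop

end IsUnitWeight

theorem expNoise_extend (P : Kernel (Fin K × X × S × Θ) ℝ) (v : WeightProcess K X) (σ l : ℝ)
    (w : S × Θ) {n : ℕ} (h : History K X n) (x : X) (a : Fin K) (r : ℝ) :
    expNoise P v σ l w (n + 1) (h.extend (x, a, r)) =
      expNoise P v σ l w n h * (Real.exp (-(l ^ 2 * σ ^ 2 / 2 * v n h x a)) *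
        Real.exp (l * v n h x a * (r - meanReward P a x w.1 w.2))) := by
  simp only [expNoise, noise, count, cumulative_extend, ← Real.exp_add]
  ring_nf

theorem SubgaussianRewards.lintegral_expNoise_extend_le {P : Kernel (Fin K × X × S × Θ) ℝ}
    {σ : ℝ≥0} (hsubG : SubgaussianRewards P σ) {v : WeightProcess K X} (hv : IsUnitWeight v)
    (l : ℝ) (w : S × Θ) {n : ℕ} (h : History K X n) (x : X) (a : Fin K) :
    ∫⁻ r, ENNReal.ofReal (expNoise P v σ l w (n + 1) (h.extend (x, a, r))) ∂P (a, x, w.1, w.2) ≤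
      ENNReal.ofReal (expNoise P v σ l w n h) := by
  set y := v n h x a
  have hG := hsubG a x w.1 w.2
  simp only [expNoise_extend]
  rw [← ofReal_integral_eq_lintegral_ofReal
    (((hG.integrable_exp_mul (l * y)).const_mul _).const_mul _)
    (Filter.Eventually.of_forall fun r => by have := expNoise_pos P v σ l w h; positivity)]
  refine ENNReal.ofReal_le_ofReal ?_
  rw [integral_const_mul, integral_const_mul]
  refine mul_le_of_le_one_right (expNoise_pos ..).le ?_
  have hsq : y * y ≤ y := mul_le_of_le_one_right (hv.nonneg ..) (hv.le_one ..)
  calc _ ≤ Real.exp (-(l ^ 2 * σ ^ 2 / 2 * y)) *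
        Real.exp (((σ ^ 2 : ℝ≥0) : ℝ) * (l * y) ^ 2 / 2) :=
        mul_le_mul_of_nonneg_left (hG.mgf_le (l * y)) (Real.exp_pos _).le
    _ = Real.exp (l ^ 2 * σ ^ 2 / 2 * (y * y - y)) := by
        rw [← Real.exp_add, NNReal.coe_pow]
        ring_nf
    _ ≤ 1 := Real.exp_le_one_iff.2 (mul_nonpos_of_nonneg_of_nonpos (by positivity) (by linarith))

end Weights

section ExponentialSupermartingale

variable {K : ℕ} {X S Θ : Type*} [MeasurableSpace X] [MeasurableSpace S] [MeasurableSpace Θ]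
  [StandardBorelSpace S] [StandardBorelSpace Θ] [Nonempty S] [Nonempty Θ]
  {P : Kernel (Fin K × X × S × Θ) ℝ} [IsMarkovKernel P] {σ : ℝ≥0}
  (hsubG : SubgaussianRewards P σ) {v : WeightProcess K X} (hv : IsUnitWeight v)
  (prior : Measure (S × Θ)) [IsProbabilityMeasure prior]
  (ctx : ∀ t, Kernel (History K X t) X) [∀ t, IsMarkovKernel (ctx t)]
  (act : X → S → Θ → Fin K) (hact : Measurable fun p : X × S × Θ => act p.1 p.2.1 p.2.2)

include hsubG hv

namespace SubgaussianRewards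

theorem lintegral_expNoise_le_one (l : ℝ) (n : ℕ) :
    ∫⁻ p, ENNReal.ofReal (expNoise P v σ l p.1 n p.2)
      ∂(mmTSLaw P prior ctx act hact n : Measure ((S × Θ) × History K X n)) ≤ 1 := by
  induction n with
  | zero => simp [expNoise, noise, count, cumulative]
  | succ n ih =>
    rw [lintegral_mmTSLaw_succ P prior ctx act hact n
      (hv.measurable_expNoise P σ l _).ennreal_ofReal]
    calc _ ≤ ∫⁻ q, ENNReal.ofReal (expNoise P v σ l q.1.1 n q.1.2)
          ∂sampleLaw (mmTSLaw P prior ctx act hact n) (ctx n) :=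
          lintegral_mono fun q => hsubG.lintegral_expNoise_extend_le hv l q.1.1 q.1.2 q.2.1 _
      _ = _ := (measurePreserving_fst_sampleLaw _ _).lintegral_comp
          (hv.measurable_expNoise P σ l n).ennreal_ofReal
      _ ≤ 1 := ih

theorem integrable_expNoise (l : ℝ) (n : ℕ) :
    Integrable (fun p => expNoise P v σ l p.1 n p.2)
      (mmTSLaw P prior ctx act hact n : Measure ((S × Θ) × History K X n)) := by
  refine ⟨(hv.measurable_expNoise P σ l n).aestronglyMeasurable, ?_⟩
  rw [hasFiniteIntegral_iff_ofReal (Filter.Eventually.of_forall fun _ => (expNoise_pos ..).le)]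
  exact (hsubG.lintegral_expNoise_le_one hv prior ctx act hact l n).trans_lt ENNReal.one_lt_top

theorem integral_expNoise_le_one (l : ℝ) (n : ℕ) :
    ∫ p, expNoise P v σ l p.1 n p.2
      ∂(mmTSLaw P prior ctx act hact n : Measure ((S × Θ) × History K X n)) ≤ 1 := by
  rw [← ENNReal.ofReal_le_one, ofReal_integral_eq_lintegral_ofReal
    (hsubG.integrable_expNoise hv prior ctx act hact l n)
    (Filter.Eventually.of_forall fun _ => (expNoise_pos ..).le)]
  exact hsubG.lintegral_expNoise_le_one hv prior ctx act hact l n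

theorem integrable_expNoise_take (l : ℝ) {j n : ℕ} (hj : j ≤ n) :
    Integrable (fun p => expNoise P v σ l p.1 j (p.2.take hj))
      (mmTSLaw P prior ctx act hact n : Measure ((S × Θ) × History K X n)) :=
  (measurePreserving_take P prior ctx act hact hj).integrable_comp_of_integrable
    (hsubG.integrable_expNoise hv prior ctx act hact l j)

theorem integrable_expNoiseSum (l : ℝ) (n : ℕ) :
    Integrable (fun p => expNoiseSum P v σ l p.1 n p.2)
      (mmTSLaw P prior ctx act hact n : Measure ((S × Θ) × History K X n)) :=
  integrable_finsetSum _ fun j _ =>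
    hsubG.integrable_expNoise_take hv prior ctx act hact l j.is_le

theorem integral_expNoiseSum_le (l : ℝ) (n : ℕ) :
    ∫ p, expNoiseSum P v σ l p.1 n p.2
      ∂(mmTSLaw P prior ctx act hact n : Measure ((S × Θ) × History K X n)) ≤ n + 1 := by
  have hround (j : Fin (n + 1)) : ∫ p, expNoise P v σ l p.1 j (p.2.take j.is_le)
      ∂(mmTSLaw P prior ctx act hact n : Measure ((S × Θ) × History K X n)) ≤ 1 := by
    have hpres := measurePreserving_take P prior ctx act hact j.is_le
    rw [← integral_map hpres.measurable.aemeasurable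
      (f := fun p : (S × Θ) × History K X j => expNoise P v σ l p.1 j p.2)
      (hv.measurable_expNoise P σ l j).aestronglyMeasurable, hpres.map_eq]
    exact hsubG.integral_expNoise_le_one hv prior ctx act hact l j
  unfold expNoiseSum
  rw [integral_finsetSum _ fun j _ =>
    hsubG.integrable_expNoise_take hv prior ctx act hact l j.is_le]
  exact (Finset.sum_le_sum fun j _ => hround j).trans_eq (by simp)

end SubgaussianRewards

end ExponentialSupermartingale

section Confidence

variable {K : ℕ} {X : Type*}

/-- The confidence event: up to now, the score of the prediction `m` has never exceeded
`c * count + b`. -/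
def Confident (u : WeightProcess K X) (m : Fin K → X → ℝ) (c b : ℝ) {n : ℕ} (h : History K X n) :
    Prop :=
  ∀ j (hj : j ≤ n), score u m j (h.take hj) ≤ c * count u j (h.take hj) + b

/-- The weights `u` stopped when confidence in the prediction `m` is lost. -/
noncomputable def stoppedWeight (u : WeightProcess K X) (m : Fin K → X → ℝ) (c b : ℝ) :
    WeightProcess K X :=
  fun _ h x a => {h | Confident u m c b h}.indicator (fun h => u _ h x a) h

variable {u : WeightProcess K X} {m : Fin K → X → ℝ} {c b : ℝ} {n : ℕ} {h : History K X n}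

theorem Confident.take (hh : Confident u m c b h) {k : ℕ} (hk : k ≤ n) :
    Confident u m c b (h.take hk) :=
  fun j hj => hh j (hj.trans hk)

theorem stoppedWeight_of_confident (hh : Confident u m c b h) (x : X) (a : Fin K) :
    stoppedWeight u m c b n h x a = u n h x a :=
  Set.indicator_of_mem (s := {h | Confident u m c b h}) hh _

theorem stoppedWeight_of_not_confident (hh : ¬ Confident u m c b h) (x : X) (a : Fin K) :
    stoppedWeight u m c b n h x a = 0 :=
  Set.indicator_of_notMem (s := {h | Confident u m c b h}) hh _

theorem Confident.cumulative_stoppedWeight (hh : Confident u m c b h) (f : X × Fin K × ℝ → ℝ) :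
    cumulative (fun t h o => stoppedWeight u m c b t h o.1 o.2.1 * f o) n h =
      cumulative (fun t h o => u t h o.1 o.2.1 * f o) n h :=
  Finset.sum_congr rfl fun t _ => by simp only [stoppedWeight_of_confident (hh.take t.2.le)]

theorem Confident.count_stoppedWeight (hh : Confident u m c b h) :
    count (stoppedWeight u m c b) n h = count u n h := by
  simpa only [mul_one, count] using hh.cumulative_stoppedWeight fun _ => 1

variable [MeasurableSpace X]

theorem IsUnitWeight.measurableSet_confident (hu : IsUnitWeight u)
    (hm : Measurable fun p : Fin K × X => m p.1 p.2) (c b : ℝ) (n : ℕ) :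
    MeasurableSet {h : History K X n | Confident u m c b h} := by
  have hscore := hu.measurable_score hm
  have hcount := hu.measurable_count
  simp only [Confident, Set.ofPred_forall]
  exact MeasurableSet.iInter fun j => MeasurableSet.iInter fun hj =>
    measurableSet_le (by fun_prop) (by fun_prop)

theorem IsUnitWeight.stoppedWeight_le (hu : IsUnitWeight u) (h : History K X n) (x : X)
    (a : Fin K) : stoppedWeight u m c b n h x a ≤ u n h x a :=
  Set.indicator_le_self' (fun _ _ => hu.nonneg ..) h

theorem isUnitWeight_stoppedWeight (hu : IsUnitWeight u)
    (hm : Measurable fun p : Fin K × X => m p.1 p.2) (c b : ℝ) :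
    IsUnitWeight (stoppedWeight u m c b) where
  measurable n := (hu.measurable n).indicator (measurable_fst (hu.measurableSet_confident hm c b n))
  nonneg _ h _ _ := Set.indicator_nonneg (fun _ _ => hu.nonneg ..) h
  le_one _ h x a := (hu.stoppedWeight_le h x a).trans (hu.le_one ..)

variable {S Θ : Type*} [MeasurableSpace S] [MeasurableSpace Θ] (P : Kernel (Fin K × X × S × Θ) ℝ)

/-- Markov's inequality for `expNoise`, kept pathwise as the last term: it follows from
`y + 1 ≤ exp y`. -/
theorem noise_le (v : WeightProcess K X) (σ L : ℝ) {l : ℝ} (hl : 0 < l) (w : S × Θ)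
    (h : History K X n) :
    noise P v w n h ≤ l * σ ^ 2 / 2 * count v n h + L / l +
      Real.exp (-L) / l * expNoise P v σ l w n h := by
  have hexp := Real.add_one_le_exp (l * noise P v w n h - l ^ 2 * σ ^ 2 / 2 * count v n h - L)
  have hsplit : Real.exp (l * noise P v w n h - l ^ 2 * σ ^ 2 / 2 * count v n h - L) =
      Real.exp (-L) * expNoise P v σ l w n h := by
    rw [expNoise, ← Real.exp_add]
    ring_nf
  refine le_of_mul_le_mul_left ?_ hl
  calc l * noise P v w n h
      ≤ l ^ 2 * σ ^ 2 / 2 * count v n h + L + Real.exp (-L) * expNoise P v σ l w n h := by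
        linarith
    _ = _ := by field_simp

variable {P}

theorem Confident.excess_le (hh : Confident u m c b h) {σ L l : ℝ} (hl : 0 < l) (w : S × Θ) :
    excess P u m w n h ≤ (c + l * σ ^ 2 / 2) * count u n h + (b + L / l) +
      Real.exp (-L) / l * expNoise P u σ l w n h := by
  have hscore : score u m n h ≤ c * count u n h + b := hh n le_rfl
  have hnoise := noise_le P u σ L hl w h
  rw [← score_add_noise]
  linarith

theorem excess_stoppedWeight_le (hu : IsUnitWeight u) (hc : 0 ≤ c) (hb : 0 ≤ b) {σ L l : ℝ}
    (hL : 0 ≤ L) (hl : 0 < l) {w : S × Θ} (hmw : ∀ a x, |m a x - meanReward P a x w.1 w.2| ≤ 1)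
    (h : History K X n) :
    excess P (stoppedWeight u m c b) m w n h ≤
      1 + (c + l * σ ^ 2 / 2) * count (stoppedWeight u m c b) n h + (b + L / l) +
        Real.exp (-L) / l * expNoiseSum P u σ l w n h := by
  have hcoef : 0 ≤ c + l * σ ^ 2 / 2 := by positivity
  have hweight : 0 ≤ Real.exp (-L) / l := by positivity
  induction n with
  | zero =>
    have hsum := mul_nonneg hweight (expNoiseSum_nonneg P u σ l w h)
    simp only [excess, count, cumulative, Finset.univ_eq_empty, Finset.sum_empty, mul_zero]
    positivity
  | succ n ih =>
    have hsum := mul_le_mul_of_nonneg_left (expNoiseSum_take_le P u σ l w h) hweight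
    specialize ih (h.take n.le_succ)
    rw [excess, cumulative_succ, count, cumulative_succ]
    by_cases hconf : Confident u m c b (h.take n.le_succ)
    · have hexcess := hconf.excess_le (P := P) (σ := σ) (L := L) hl w
      have hround : u n (h.take n.le_succ) (h (Fin.last n)).1 (h (Fin.last n)).2.1 *
          (m (h (Fin.last n)).2.1 (h (Fin.last n)).1 -
            meanReward P (h (Fin.last n)).2.1 (h (Fin.last n)).1 w.1 w.2) ≤ 1 :=
        (mul_le_of_le_one_right (hu.nonneg ..) ((le_abs_self _).trans (hmw _ _))).trans
          (hu.le_one ..)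
      have hcount := mul_nonneg hcoef
        (hu.nonneg n (h.take n.le_succ) (h (Fin.last n)).1 (h (Fin.last n)).2.1)
      have hlast := mul_le_mul_of_nonneg_left
        (expNoise_le_expNoiseSum P u σ l w n.le_succ h) hweight
      rw [hconf.cumulative_stoppedWeight fun o => m o.2.1 o.1 - meanReward P o.2.1 o.1 w.1 w.2,
        ← count, hconf.count_stoppedWeight, stoppedWeight_of_confident hconf]
      rw [excess] at hexcess
      linarith
    · rw [stoppedWeight_of_not_confident hconf, zero_mul, add_zero, add_zero]
      rw [excess, count] at ih
      linarith

theorem one_le_expNoiseSum_of_not_confident (hu : IsUnitWeight u) {ε σ L l : ℝ} (hl : 0 < l)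
    {w : S × Θ} (hmw : ∀ a x, |m a x - meanReward P a x w.1 w.2| ≤ ε)
    (hexit : ¬ Confident u m (ε + l * σ ^ 2 / 2) (L / l) h) :
    1 ≤ Real.exp (-L) * expNoiseSum P u σ (-l) w n h := by
  simp only [Confident, not_forall, not_le] at hexit
  obtain ⟨j, hj, hexit⟩ := hexit
  refine le_trans ?_ (mul_le_mul_of_nonneg_left
    (expNoise_le_expNoiseSum P u σ (-l) w hj h) (Real.exp_pos _).le)
  set h' := h.take hj
  have hexcess : excess P u m w j h' ≤ ε * count u j h' := by
    simp only [excess, count, cumulative, Finset.mul_sum]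
    exact Finset.sum_le_sum fun t _ => (mul_le_mul_of_nonneg_left
      ((le_abs_self _).trans (hmw _ _)) (hu.nonneg ..)).trans_eq (mul_comm _ _)
  have hnoise : l * σ ^ 2 / 2 * count u j h' + L / l < -noise P u w j h' := by
    linarith [score_add_noise P u m w h']
  rw [expNoise, ← Real.exp_add, Real.one_le_exp_iff]
  calc (0 : ℝ) ≤ l * (-noise P u w j h' - (l * σ ^ 2 / 2 * count u j h' + L / l)) :=
        mul_nonneg hl.le (sub_nonneg.2 hnoise.le)
    _ = _ := by field_simp; ring

end Confidence

section PosteriorWeights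

theorem norm_indicator_one_le_one {Y : Type*} (E : Set Y) (y : Y) :
    ‖E.indicator (1 : Y → ℝ) y‖ ≤ 1 :=
  (norm_indicator_le_norm_self 1 y).trans_eq norm_one

theorem integral_eq_sum_setIntegral_fiber {Y α : Type*} [MeasurableSpace Y] [Fintype α]
    [MeasurableSpace α] [MeasurableSingletonClass α] {ν : Measure Y} {f : Y → α}
    (hf : Measurable f) {F : Y → ℝ} (hF : Integrable F ν) :
    ∫ y, F y ∂ν = ∑ a, ∫ y in f ⁻¹' {a}, F y ∂ν := by
  rw [← integral_iUnion_fintype (fun a => hf (measurableSet_singleton a))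
      (pairwise_disjoint_fiber f) fun _ => hF.integrableOn,
    ← Set.preimage_iUnion, Set.iUnion_of_singleton, Set.preimage_univ, setIntegral_univ]

theorem integral_indicator_mul_comp {Y α : Type*} [MeasurableSpace Y] [Finite α]
    [MeasurableSpace α] [MeasurableSingletonClass α] (ν : Measure Y) [IsFiniteMeasure ν]
    {f : Y → α} (hf : Measurable f) {E : Set Y} (hE : MeasurableSet E) (g : α → ℝ) :
    ∫ y, E.indicator 1 y * g (f y) ∂ν = ∫ y, ν[|f ⁻¹' {f y}].real E * g (f y) ∂ν := by
  have := Fintype.ofFinite α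
  have hfiber (a : α) : MeasurableSet (f ⁻¹' {a}) := hf (measurableSet_singleton a)
  have hg : Integrable (fun y => g (f y)) ν :=
    (integrable_map_measure (by fun_prop) hf.aemeasurable).1 .of_finite
  have hcond : Measurable fun y => ν[|f ⁻¹' {f y}].real E :=
    (measurable_of_finite fun a => ν[|f ⁻¹' {a}].real E).comp hf
  rw [integral_eq_sum_setIntegral_fiber hf (hg.bdd_mul
      (measurable_one.indicator hE).aestronglyMeasurable
      (.of_forall (norm_indicator_one_le_one E))),
    integral_eq_sum_setIntegral_fiber hf (hg.bdd_mul hcond.aestronglyMeasurable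
      (.of_forall fun _ => (Real.norm_of_nonneg measureReal_nonneg).trans_le measureReal_le_one))]
  refine Finset.sum_congr rfl fun a _ => ?_
  have hfiber_prob : ν.real (f ⁻¹' {a} ∩ E) = ν[|f ⁻¹' {a}].real E * ν.real (f ⁻¹' {a}) := by
    simp only [measureReal_def, ← cond_mul_eq_inter (hfiber a) E ν, ENNReal.toReal_mul]
  calc ∫ y in f ⁻¹' {a}, E.indicator 1 y * g (f y) ∂ν
      = ∫ y in f ⁻¹' {a}, E.indicator 1 y * g a ∂ν :=
        setIntegral_congr_fun (hfiber a) fun y hy => by rw [show f y = a from hy]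
    _ = ν.real (f ⁻¹' {a} ∩ E) * g a := by
        rw [integral_mul_const, integral_indicator_one hE, measureReal_restrict_apply hE,
          Set.inter_comm]
    _ = ∫ _ in f ⁻¹' {a}, ν[|f ⁻¹' {a}].real E * g a ∂ν := by
        rw [setIntegral_const, smul_eq_mul, hfiber_prob]
        ring
    _ = ∫ y in f ⁻¹' {a}, ν[|f ⁻¹' {f y}].real E * g (f y) ∂ν :=
        setIntegral_congr_fun (hfiber a) fun y hy => by rw [show f y = a from hy]

variable {K : ℕ} {X S Θ : Type*} [MeasurableSpace X] [MeasurableSpace S] [MeasurableSpace Θ]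
  [StandardBorelSpace S] [StandardBorelSpace Θ] [Nonempty S] [Nonempty Θ]

theorem integral_sampleLaw {t : ℕ} (law : ProbabilityMeasure ((S × Θ) × History K X t))
    (ctx : Kernel (History K X t) X) [IsMarkovKernel ctx] {f : Draw K X S Θ t → ℝ}
    (hf : Integrable f (sampleLaw law ctx)) :
    ∫ q, f q ∂sampleLaw law ctx =
      ∫ p, ∫ x, ∫ w, f (p, x, w) ∂posterior law p.2 ∂ctx p.2
        ∂(law : Measure ((S × Θ) × History K X t)) := by
  rw [sampleLaw] at hf ⊢
  rw [Measure.integral_compProd hf]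
  refine integral_congr_ae ?_
  filter_upwards [((Measure.integrable_compProd_iff hf.1).1 hf).1] with p hp
  rw [Kernel.comap_apply, Kernel.prod_apply] at hp ⊢
  exact integral_prod _ hp

variable (act : X → S → Θ → Fin K) {t : ℕ}
  (law : ProbabilityMeasure ((S × Θ) × History K X t))

/-- The conditional probability, under the posterior, that the sample lies in `E` given that it
makes the agent choose the action `a` in the context `x`. -/
noncomputable def sampleProb (E : Set (S × Θ)) (h : History K X t) (x : X) (a : Fin K) : ℝ :=
  (posterior law h)[|(fun w => act x w.1 w.2) ⁻¹' {a}].real E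

theorem sampleProb_nonneg (E : Set (S × Θ)) (h : History K X t) (x : X) (a : Fin K) :
    0 ≤ sampleProb act law E h x a :=
  measureReal_nonneg

theorem sampleProb_le_one (E : Set (S × Θ)) (h : History K X t) (x : X) (a : Fin K) :
    sampleProb act law E h x a ≤ 1 :=
  measureReal_le_one

theorem sum_sampleProb_le_one {ι : Type*} [Fintype ι] {E : ι → Set (S × Θ)}
    (hE : ∀ i, MeasurableSet (E i)) (hdisj : Pairwise (Function.onFun Disjoint E))
    (h : History K X t) (x : X) (a : Fin K) : ∑ i, sampleProb act law (E i) h x a ≤ 1 :=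
  (sum_measureReal_le_measureReal_univ (fun i _ => hE i) (hdisj.set_pairwise _)).trans
    measureReal_le_one

variable {act} (hact : Measurable fun p : X × S × Θ => act p.1 p.2.1 p.2.2)

include hact

theorem measurable_sampleProb {E : Set (S × Θ)} (hE : MeasurableSet E) :
    Measurable fun p : History K X t × X × Fin K => sampleProb act law E p.1 p.2.1 p.2.2 := by
  let κ : Kernel (History K X t × X × Fin K) (S × Θ) :=
    (posterior law).comap Prod.fst measurable_fst
  have hchosen : MeasurableSet {q : (History K X t × X × Fin K) × S × Θ |
      act q.1.2.1 q.2.1 q.2.2 = q.1.2.2} :=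
    measurableSet_eq_fun (hact.comp (by fun_prop : Measurable
      fun q : (History K X t × X × Fin K) × S × Θ => (q.1.2.1, q.2))) (by fun_prop)
  have hnum := Kernel.measurable_kernel_prodMk_left (κ := κ) (hchosen.inter (measurable_snd hE))
  have hden := Kernel.measurable_kernel_prodMk_left (κ := κ) hchosen
  have hformula (p : History K X t × X × Fin K) : sampleProb act law E p.1 p.2.1 p.2.2 = _ :=
    congrArg ENNReal.toReal (cond_apply
      (hact.comp measurable_prodMk_left (measurableSet_singleton p.2.2)) (posterior law p.1) E)
  simp only [hformula]
  exact (hden.inv.mul hnum).ennreal_toReal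

theorem integral_indicator_mul_choice (ctx : Kernel (History K X t) X) [IsMarkovKernel ctx]
    {E : Set (S × Θ)} (hE : MeasurableSet E) {g : (S × Θ) × History K X t × X × Fin K → ℝ}
    (hg : Integrable (fun q => g (q.choice act)) (sampleLaw law ctx)) :
    ∫ q, E.indicator 1 q.2.2 * g (q.choice act) ∂sampleLaw law ctx =
      ∫ q, sampleProb act law E q.1.2 q.2.1 (q.action act) * g (q.choice act)
        ∂sampleLaw law ctx := by
  have := Draw.measurable_action hact (t := t)
  have hprob : Measurable fun q : Draw K X S Θ t =>
      sampleProb act law E q.1.2 q.2.1 (q.action act) :=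
    (measurable_sampleProb law hact hE).comp
      (g := fun p : History K X t × X × Fin K => sampleProb act law E p.1 p.2.1 p.2.2)
      (f := fun q : Draw K X S Θ t => (q.1.2, q.2.1, q.action act)) (by fun_prop)
  have hmem : Measurable fun q : Draw K X S Θ t => E.indicator (1 : S × Θ → ℝ) q.2.2 :=
    (measurable_one.indicator hE).comp measurable_snd.snd
  have hleft := hg.bdd_mul (c := 1) hmem.aestronglyMeasurable
    (.of_forall fun q => norm_indicator_one_le_one E q.2.2)
  have hright := hg.bdd_mul (c := 1) hprob.aestronglyMeasurable
    (.of_forall fun q => (Real.norm_of_nonneg (sampleProb_nonneg ..)).trans_le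
      (sampleProb_le_one ..))
  rw [integral_sampleLaw law ctx hleft, integral_sampleLaw law ctx hright]
  refine integral_congr_ae (.of_forall fun p => integral_congr_ae (.of_forall fun x => ?_))
  exact integral_indicator_mul_comp (posterior law p.2)
    (hact.comp (measurable_prodMk_left (x := x))) hE fun a => g (p.1, p.2, x, a)

end PosteriorWeights

section Failure

variable {K : ℕ} {X S Θ : Type*} [MeasurableSpace X] [MeasurableSpace S] [MeasurableSpace Θ]

/-- No mean reward changes by more than `1` when the state and the model change. -/
def UnitOscillation (P : Kernel (Fin K × X × S × Θ) ℝ) : Prop :=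
  ∀ a x s s' θ θ', |meanReward P a x s θ - meanReward P a x s' θ'| ≤ 1

/-- The prediction `m s a x` of the mean rewards is accurate up to `ε` for the models in `G`, and
up to `1` for all models. -/
structure IsAccurateOn (P : Kernel (Fin K × X × S × Θ) ℝ) (m : S → Fin K → X → ℝ) (G : Set Θ)
    (ε : ℝ) : Prop where
  measurable : ∀ s, Measurable fun p : Fin K × X => m s p.1 p.2
  measurableSet : MeasurableSet G
  abs_sub_le : ∀ θ ∈ G, ∀ s a x, |m s a x - meanReward P a x s θ| ≤ ε
  abs_sub_le_one : ∀ s a x s' θ, |m s a x - meanReward P a x s' θ| ≤ 1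

variable [Fintype S]

/-- Dominates the indicator of the event that, for the true state and model `w`, either the model
is not in `G` or confidence in the prediction for the true state is lost. -/
noncomputable def failure (P : Kernel (Fin K × X × S × Θ) ℝ) (u : S → WeightProcess K X)
    (G : Set Θ) (σ L l : ℝ) (w : S × Θ) (n : ℕ) (h : History K X n) : ℝ :=
  Gᶜ.indicator 1 w.2 + ∑ s, Real.exp (-L) * expNoiseSum P (u s) σ (-l) w n h

section Pathwise

variable {P : Kernel (Fin K × X × S × Θ) ℝ} {u : S → WeightProcess K X}
  {m : S → Fin K → X → ℝ} {G : Set Θ} {ε σ L l : ℝ} {w : S × Θ} {n : ℕ} {h : History K X n}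

theorem failure_nonneg : 0 ≤ failure P u G σ L l w n h :=
  add_nonneg (Set.indicator_nonneg (fun _ _ => zero_le_one) _)
    (Finset.sum_nonneg fun _ _ => mul_nonneg (Real.exp_pos _).le (expNoiseSum_nonneg ..))

theorem one_le_failure_of_notMem (hw : w.2 ∉ G) : 1 ≤ failure P u G σ L l w n h := by
  rw [failure, Set.indicator_of_mem (Set.mem_compl hw)]
  exact le_add_of_nonneg_right
    (Finset.sum_nonneg fun _ _ => mul_nonneg (Real.exp_pos _).le (expNoiseSum_nonneg ..))

theorem one_le_failure_of_not_confident (hu : ∀ s, IsUnitWeight (u s))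
    (hm : IsAccurateOn P m G ε) (hl : 0 < l) (hw : w.2 ∈ G)
    (hexit : ¬ Confident (u w.1) (m w.1) (ε + l * σ ^ 2 / 2) (L / l) h) :
    1 ≤ failure P u G σ L l w n h :=
  calc 1 ≤ Real.exp (-L) * expNoiseSum P (u w.1) σ (-l) w n h :=
        one_le_expNoiseSum_of_not_confident (hu w.1) hl (hm.abs_sub_le w.2 hw w.1) hexit
    _ ≤ ∑ s, Real.exp (-L) * expNoiseSum P (u s) σ (-l) w n h :=
        Finset.single_le_sum (f := fun s => Real.exp (-L) * expNoiseSum P (u s) σ (-l) w n h)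
          (fun _ _ => mul_nonneg (Real.exp_pos _).le (expNoiseSum_nonneg ..)) (Finset.mem_univ w.1)
    _ ≤ failure P u G σ L l w n h :=
        le_add_of_nonneg_left (Set.indicator_nonneg (fun _ _ => zero_le_one) _)

end Pathwise

variable [StandardBorelSpace S] [StandardBorelSpace Θ] [Nonempty S] [Nonempty Θ]
  {P : Kernel (Fin K × X × S × Θ) ℝ} [IsMarkovKernel P] {σ : ℝ≥0}
  (hsubG : SubgaussianRewards P σ) {u : S → WeightProcess K X} (hu : ∀ s, IsUnitWeight (u s))
  (prior : Measure (S × Θ)) [IsProbabilityMeasure prior]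
  (ctx : ∀ t, Kernel (History K X t) X) [∀ t, IsMarkovKernel (ctx t)]
  (act : X → S → Θ → Fin K) (hact : Measurable fun p : X × S × Θ => act p.1 p.2.1 p.2.2)
  {G : Set Θ} (hG : MeasurableSet G)

include hsubG hu

include hG in
theorem SubgaussianRewards.integrable_failure (L l : ℝ) (n : ℕ) :
    Integrable (fun p => failure P u G σ L l p.1 n p.2)
      (mmTSLaw P prior ctx act hact n : Measure ((S × Θ) × History K X n)) := by
  refine Integrable.add ?_ (integrable_finsetSum _ fun s _ =>
    (hsubG.integrable_expNoiseSum (hu s) prior ctx act hact (-l) n).const_mul _)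
  exact (integrable_const (1 : ℝ)).indicator (measurable_fst.snd hG.compl)

include hG in
theorem SubgaussianRewards.integral_failure_le (L l : ℝ) (n : ℕ) :
    ∫ p, failure P u G σ L l p.1 n p.2
        ∂(mmTSLaw P prior ctx act hact n : Measure ((S × Θ) × History K X n)) ≤
      prior.snd.real Gᶜ + Fintype.card S * (Real.exp (-L) * (n + 1)) := by
  have hindicator : Integrable (fun p => Gᶜ.indicator (1 : Θ → ℝ) p.1.2)
      (mmTSLaw P prior ctx act hact n : Measure ((S × Θ) × History K X n)) :=
    (integrable_const (1 : ℝ)).indicator (measurable_fst.snd hG.compl)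
  have hsum (s : S) : Integrable (fun p => Real.exp (-L) * expNoiseSum P (u s) σ (-l) p.1 n p.2)
      (mmTSLaw P prior ctx act hact n : Measure ((S × Θ) × History K X n)) :=
    (hsubG.integrable_expNoiseSum (hu s) prior ctx act hact (-l) n).const_mul _
  have hprior : (mmTSLaw P prior ctx act hact n : Measure ((S × Θ) × History K X n)).map
      (fun p => p.1.2) = prior.snd := by
    have := congrArg (Measure.map Prod.snd) (map_fst_mmTSLaw P prior ctx act hact n)
    rwa [Measure.map_map measurable_snd measurable_fst] at this
  unfold failure
  rw [integral_add hindicator (integrable_finsetSum _ fun s _ => hsum s),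
    integral_finsetSum _ fun s _ => hsum s,
    ← integral_map (f := Gᶜ.indicator 1) measurable_fst.snd.aemeasurable
      (measurable_one.indicator hG.compl).aestronglyMeasurable,
    hprior, integral_indicator_one hG.compl, ← nsmul_eq_mul, ← Finset.card_univ]
  refine add_le_add_right (Finset.sum_le_card_nsmul _ _ _ fun s _ => ?_) _
  rw [integral_const_mul]
  exact mul_le_mul_of_nonneg_left
    (hsubG.integral_expNoiseSum_le (hu s) prior ctx act hact (-l) n) (Real.exp_pos _).le

include hG in
theorem SubgaussianRewards.integrable_failure_sample (L l : ℝ) (t : ℕ) :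
    Integrable (fun q => failure P u G σ L l q.2.2 t q.1.2)
      (sampleLaw (mmTSLaw P prior ctx act hact t) (ctx t)) :=
  (measurePreserving_sample _ (ctx t)).integrable_comp_of_integrable
    (hsubG.integrable_failure hu prior ctx act hact hG L l t)

include hG in
theorem SubgaussianRewards.integral_failure_sample_le (L l : ℝ) (t : ℕ) :
    ∫ q, failure P u G σ L l q.2.2 t q.1.2
        ∂sampleLaw (mmTSLaw P prior ctx act hact t) (ctx t) ≤
      prior.snd.real Gᶜ + Fintype.card S * (Real.exp (-L) * (t + 1)) := by
  have hsample := measurePreserving_sample (mmTSLaw P prior ctx act hact t) (ctx t)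
  have hfailure := hsubG.integrable_failure hu prior ctx act hact hG L l t
  rw [← integral_map (f := fun p => failure P u G σ L l p.1 t p.2)
    hsample.measurable.aemeasurable (hsample.map_eq ▸ hfailure.aestronglyMeasurable),
    hsample.map_eq]
  exact hsubG.integral_failure_le hu prior ctx act hact hG L l t

end Failure

section Rounds

variable {K : ℕ} {X S Θ : Type*} [MeasurableSpace X] [MeasurableSpace S] [MeasurableSpace Θ]

/-- The mean reward under `w` of the action that `act` selects in the context `x` for `w` itself;
this is the largest mean reward when `act` is an argmax. -/
noncomputable def optimalReward (P : Kernel (Fin K × X × S × Θ) ℝ) (act : X → S → Θ → Fin K)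
    (x : X) (w : S × Θ) : ℝ :=
  meanReward P (act x w.1 w.2) x w.1 w.2

/-- The regret of a round, as a function of the choice made in it. -/
noncomputable def roundRegret (P : Kernel (Fin K × X × S × Θ) ℝ) (act : X → S → Θ → Fin K)
    {t : ℕ} (y : (S × Θ) × History K X t × X × Fin K) : ℝ :=
  optimalReward P act y.2.2.1 y.1 - meanReward P y.2.2.2 y.2.2.1 y.1.1 y.1.2

/-- The difference between the predicted and the mean reward of a choice. -/
noncomputable def predictionGap (P : Kernel (Fin K × X × S × Θ) ℝ) (m : Fin K → X → ℝ)
    {t : ℕ} (y : (S × Θ) × History K X t × X × Fin K) : ℝ :=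
  m y.2.2.2 y.2.2.1 - meanReward P y.2.2.2 y.2.2.1 y.1.1 y.1.2

/-- The prediction gap, replaced by `0` once confidence in the prediction is lost. -/
noncomputable def confidentGap (P : Kernel (Fin K × X × S × Θ) ℝ) (u : WeightProcess K X)
    (m : Fin K → X → ℝ) (c b : ℝ) {t : ℕ} (y : (S × Θ) × History K X t × X × Fin K) : ℝ :=
  {h | Confident u m c b h}.indicator (fun _ => predictionGap P m y) y.2.1

/-- How much the posterior sample overestimates the mean reward of the action it leads to. -/
noncomputable def Draw.overestimate (P : Kernel (Fin K × X × S × Θ) ℝ)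
    (act : X → S → Θ → Fin K) {t : ℕ} (q : Draw K X S Θ t) : ℝ :=
  meanReward P (q.action act) q.2.1 q.2.2.1 q.2.2.2 -
    meanReward P (q.action act) q.2.1 q.1.1.1 q.1.1.2

theorem roundRegret_choice (P : Kernel (Fin K × X × S × Θ) ℝ) (act : X → S → Θ → Fin K)
    {t : ℕ} (q : Draw K X S Θ t) :
    roundRegret P act (q.choice act) = q.overestimate P act +
      (optimalReward P act q.2.1 q.1.1 - optimalReward P act q.2.1 q.2.2) := by
  simp only [roundRegret, Draw.overestimate, Draw.choice, Draw.action, optimalReward]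
  ring

theorem IsArgmax.abs_optimalReward_sub_le {P : Kernel (Fin K × X × S × Θ) ℝ}
    {act : X → S → Θ → Fin K} (hargmax : IsArgmax P act) (hosc : UnitOscillation P) (x : X)
    (w w' : S × Θ) : |optimalReward P act x w - optimalReward P act x w'| ≤ 1 := by
  have hle (w w' : S × Θ) : optimalReward P act x w - optimalReward P act x w' ≤ 1 :=
    (sub_le_sub_left (hargmax x w'.1 w'.2 (act x w.1 w.2)) _).trans
      ((le_abs_self _).trans (hosc ..))
  exact abs_sub_le_iff.2 ⟨hle w w', hle w' w⟩

section Measurability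

variable {P : Kernel (Fin K × X × S × Θ) ℝ} {act : X → S → Θ → Fin K} {t : ℕ}

@[fun_prop]
theorem measurable_optimalReward (hact : Measurable fun p : X × S × Θ => act p.1 p.2.1 p.2.2)
    {Ω : Type*} [MeasurableSpace Ω] {x : Ω → X} {w : Ω → S × Θ} (hx : Measurable x)
    (hw : Measurable w) : Measurable fun ω => optimalReward P act (x ω) (w ω) :=
  measurable_meanReward P (hact.comp (hx.prodMk hw)) hx hw.fst hw.snd

theorem measurable_roundRegret (hact : Measurable fun p : X × S × Θ => act p.1 p.2.1 p.2.2) :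
    Measurable (roundRegret P act : (S × Θ) × History K X t × X × Fin K → ℝ) := by
  unfold roundRegret
  fun_prop

theorem measurable_predictionGap {m : Fin K → X → ℝ}
    (hm : Measurable fun p : Fin K × X => m p.1 p.2) :
    Measurable (predictionGap P m : (S × Θ) × History K X t × X × Fin K → ℝ) := by
  unfold predictionGap
  fun_prop

theorem IsUnitWeight.measurable_mul_predictionGap {v : WeightProcess K X} (hv : IsUnitWeight v)
    {m : Fin K → X → ℝ} (hm : Measurable fun p : Fin K × X => m p.1 p.2) (t : ℕ) :
    Measurable fun y : (S × Θ) × History K X t × X × Fin K =>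
      v t y.2.1 y.2.2.1 y.2.2.2 * predictionGap P m y :=
  ((hv.measurable t).comp measurable_snd).mul (measurable_predictionGap hm)

end Measurability

section ConfidentGap

variable {P : Kernel (Fin K × X × S × Θ) ℝ} {u : WeightProcess K X} {m : Fin K → X → ℝ} {c b : ℝ}
  {t : ℕ} {y : (S × Θ) × History K X t × X × Fin K}

theorem confidentGap_of_confident (hy : Confident u m c b y.2.1) :
    confidentGap P u m c b y = predictionGap P m y :=
  Set.indicator_of_mem (s := {h | Confident u m c b h}) hy _

theorem confidentGap_of_not_confident (hy : ¬ Confident u m c b y.2.1) :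
    confidentGap P u m c b y = 0 :=
  Set.indicator_of_notMem (s := {h | Confident u m c b h}) hy _

theorem mul_confidentGap :
    u t y.2.1 y.2.2.1 y.2.2.2 * confidentGap P u m c b y =
      stoppedWeight u m c b t y.2.1 y.2.2.1 y.2.2.2 * predictionGap P m y := by
  by_cases hy : Confident u m c b y.2.1
  · rw [confidentGap_of_confident hy, stoppedWeight_of_confident hy]
  · rw [confidentGap_of_not_confident hy, stoppedWeight_of_not_confident hy, mul_zero, zero_mul]

theorem abs_confidentGap_le (hm : |predictionGap P m y| ≤ 1) : |confidentGap P u m c b y| ≤ 1 :=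
  (norm_indicator_le_norm_self (fun _ => predictionGap P m y) y.2.1).trans hm

theorem measurable_confidentGap (hu : IsUnitWeight u)
    (hm : Measurable fun p : Fin K × X => m p.1 p.2) :
    Measurable (confidentGap P u m c b : (S × Θ) × History K X t × X × Fin K → ℝ) :=
  (measurable_predictionGap hm).indicator
    (measurable_fst.comp measurable_snd (hu.measurableSet_confident hm c b t))

theorem IsAccurateOn.integrable_confidentGap {m : S → Fin K → X → ℝ}
    {G : Set Θ} {ε : ℝ} (hm : IsAccurateOn P m G ε) (hu : IsUnitWeight u) (c b : ℝ) (s : S)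
    {act : X → S → Θ → Fin K} (hact : Measurable fun p : X × S × Θ => act p.1 p.2.1 p.2.2)
    (μ : Measure (Draw K X S Θ t)) [IsFiniteMeasure μ] :
    Integrable (fun q => confidentGap P u (m s) c b (q.choice act)) μ :=
  .of_bound ((measurable_confidentGap hu (hm.measurable s)).comp
      (Draw.measurable_choice hact)).aestronglyMeasurable 1
    (.of_forall fun _ => abs_confidentGap_le (hm.abs_sub_le_one ..))

end ConfidentGap

theorem sum_indicator_singleton_prod_mul {ι α : Type*} [Fintype ι] (G : Set α) (i : ι) (y : α)
    (F : ι → ℝ) :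
    ∑ j, ({j} ×ˢ G).indicator (1 : ι × α → ℝ) (i, y) * F j = G.indicator 1 y * F i := by
  classical
  rw [Finset.sum_eq_single i (fun j _ hj => by simp [hj.symm]) (by simp)]
  by_cases hy : y ∈ G <;> simp [hy]

theorem Draw.overestimate_le {P : Kernel (Fin K × X × S × Θ) ℝ} (hosc : UnitOscillation P)
    (act : X → S → Θ → Fin K) [Fintype S] {u : S → WeightProcess K X}
    (hu : ∀ s, IsUnitWeight (u s)) {m : S → Fin K → X → ℝ} {G : Set Θ} {ε : ℝ} (hε : 0 ≤ ε)
    (hm : IsAccurateOn P m G ε) (σ L : ℝ) {l : ℝ} (hl : 0 < l) {t : ℕ} (q : Draw K X S Θ t) :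
    q.overestimate P act ≤ failure P u G σ L l q.2.2 t q.1.2 + ε +
      ∑ s, ({s} ×ˢ G).indicator 1 q.2.2 *
        confidentGap P (u s) (m s) (ε + l * σ ^ 2 / 2) (L / l) (q.choice act) := by
  obtain ⟨⟨w, h⟩, x, b, θ⟩ := q
  have hone := (abs_le.1 (hosc (act x b θ) x b w.1 θ w.2)).2
  rw [sum_indicator_singleton_prod_mul]
  by_cases hθ : θ ∈ G
  · rw [Set.indicator_of_mem hθ, Pi.one_apply, one_mul]
    by_cases hh : Confident (u b) (m b) (ε + l * σ ^ 2 / 2) (L / l) h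
    · rw [confidentGap_of_confident (y := Draw.choice act ((w, h), x, b, θ)) hh]
      have haccurate := (abs_le.1 (hm.abs_sub_le θ hθ b (act x b θ) x)).1
      have hfailure := failure_nonneg (P := P) (u := u) (G := G) (σ := σ) (L := L) (l := l)
        (w := (b, θ)) (h := h)
      simp only [overestimate, predictionGap, choice, action]
      linarith
    · rw [confidentGap_of_not_confident (y := Draw.choice act ((w, h), x, b, θ)) hh]
      have hfailure := one_le_failure_of_not_confident (w := (b, θ)) hu hm hl hθ hh
      simp only [overestimate, action]
      linarith
  · rw [Set.indicator_of_notMem hθ, zero_mul]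
    have hfailure := one_le_failure_of_notMem (P := P) (u := u) (G := G) (σ := σ) (L := L)
      (l := l) (w := (b, θ)) (h := h) hθ
    simp only [overestimate, action]
    linarith

section Integrals

variable [StandardBorelSpace S] [StandardBorelSpace Θ] [Nonempty S] [Nonempty Θ]
  {P : Kernel (Fin K × X × S × Θ) ℝ} (hosc : UnitOscillation P)
  {act : X → S → Θ → Fin K} (hact : Measurable fun p : X × S × Θ => act p.1 p.2.1 p.2.2)
  {t : ℕ} (law : ProbabilityMeasure ((S × Θ) × History K X t))
  (ctx : Kernel (History K X t) X) [IsMarkovKernel ctx]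

include hosc hact

theorem integrable_overestimate :
    Integrable (fun q => q.overestimate P act) (sampleLaw law ctx) := by
  have hmeas : Measurable fun q : Draw K X S Θ t => q.overestimate P act := by
    have := Draw.measurable_action hact (t := t)
    unfold Draw.overestimate
    fun_prop
  exact .of_bound hmeas.aestronglyMeasurable 1 (.of_forall fun q => hosc ..)

theorem integrable_roundRegret (hargmax : IsArgmax P act) :
    Integrable (fun q => roundRegret P act (q.choice act)) (sampleLaw law ctx) := by
  have hmeas := (measurable_roundRegret (P := P) (t := t) hact).comp
    (Draw.measurable_choice hact)
  refine .of_bound hmeas.aestronglyMeasurable 2 (.of_forall fun q => ?_)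
  rw [roundRegret_choice, Real.norm_eq_abs]
  have hover : |q.overestimate P act| ≤ 1 := hosc ..
  have hoptimal := hargmax.abs_optimalReward_sub_le hosc q.2.1 q.1.1 q.2.2
  exact (abs_add_le _ _).trans (by linarith)

theorem integral_roundRegret_eq (hargmax : IsArgmax P act) :
    ∫ q, roundRegret P act (q.choice act) ∂sampleLaw law ctx =
      ∫ q, q.overestimate P act ∂sampleLaw law ctx := by
  have hround := integrable_roundRegret hosc hact law ctx hargmax
  have hover := integrable_overestimate hosc hact law ctx
  rw [← sub_eq_zero, ← integral_sub hround hover]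
  simp only [roundRegret_choice, add_sub_cancel_left]
  exact integral_eq_zero_of_exchange_eq_neg law ctx (by fun_prop) fun q => (neg_sub _ _).symm

end Integrals

end Rounds

section RegretBound

variable {K : ℕ} {X S Θ : Type*} [MeasurableSpace X] [MeasurableSpace S] [MeasurableSpace Θ]
  [StandardBorelSpace S] [StandardBorelSpace Θ] [Nonempty S] [Nonempty Θ]
  (P : Kernel (Fin K × X × S × Θ) ℝ) [IsMarkovKernel P]
  (prior : Measure (S × Θ)) [IsProbabilityMeasure prior]
  (ctx : ∀ t, Kernel (History K X t) X) [∀ t, IsMarkovKernel (ctx t)]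
  {act : X → S → Θ → Fin K} (hact : Measurable fun p : X × S × Θ => act p.1 p.2.1 p.2.2)

/-- The weights `P(B_t = s, θ̂_t ∈ G | H_t, X_t, A_t)` with which the agent uses the prediction for
the state `s` and a model in `G`. -/
noncomputable def stateWeight (G : Set Θ) (s : S) : WeightProcess K X :=
  fun t => sampleProb act (mmTSLaw P prior ctx act hact t) ({s} ×ˢ G)

variable {G : Set Θ} (hG : MeasurableSet G)

include hG

theorem isUnitWeight_stateWeight (s : S) : IsUnitWeight (stateWeight P prior ctx hact G s) where
  measurable _ := measurable_sampleProb _ hact ((measurableSet_singleton s).prod hG)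
  nonneg _ := sampleProb_nonneg act _ _
  le_one _ := sampleProb_le_one act _ _

theorem sum_stateWeight_le_one [Fintype S] {t : ℕ} (h : History K X t) (x : X) (a : Fin K) :
    ∑ s, stateWeight P prior ctx hact G s t h x a ≤ 1 :=
  sum_sampleProb_le_one act _ (fun s => (measurableSet_singleton s).prod hG)
    (fun _ _ hs => Set.disjoint_prod.2 (.inl (Set.disjoint_singleton.2 hs))) h x a

omit hG

variable {P} {m : S → Fin K → X → ℝ} {ε : ℝ} (hm : IsAccurateOn P m G ε)

include hm

theorem integral_indicator_mul_confidentGap (c b : ℝ) (s : S) (t : ℕ) :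
    ∫ q, ({s} ×ˢ G).indicator 1 q.2.2 *
        confidentGap P (stateWeight P prior ctx hact G s) (m s) c b (q.choice act)
        ∂sampleLaw (mmTSLaw P prior ctx act hact t) (ctx t) =
      ∫ q, stoppedWeight (stateWeight P prior ctx hact G s) (m s) c b t q.1.2 q.2.1
          (q.action act) * predictionGap P (m s) (q.choice act)
        ∂sampleLaw (mmTSLaw P prior ctx act hact t) (ctx t) := by
  rw [integral_indicator_mul_choice _ hact (ctx t)
    ((measurableSet_singleton s).prod hm.measurableSet)
    (hm.integrable_confidentGap
      (isUnitWeight_stateWeight P prior ctx hact hm.measurableSet s) c b s hact _)]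
  exact integral_congr_ae (.of_forall fun q => mul_confidentGap
    (u := stateWeight P prior ctx hact G s) (y := q.choice act))

variable [Fintype S] {σ : ℝ≥0} (hosc : UnitOscillation P) (hargmax : IsArgmax P act)

include hosc in
theorem integral_overestimate_le (hsubG : SubgaussianRewards P σ) (hε : 0 ≤ ε)
    {u : S → WeightProcess K X} (hu : ∀ s, IsUnitWeight (u s)) (L : ℝ) {l : ℝ} (hl : 0 < l)
    (t : ℕ) :
    ∫ q, q.overestimate P act ∂sampleLaw (mmTSLaw P prior ctx act hact t) (ctx t) ≤
      prior.snd.real Gᶜ + Fintype.card S * (Real.exp (-L) * (t + 1)) + ε +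
        ∑ s, ∫ q, ({s} ×ˢ G).indicator 1 q.2.2 *
            confidentGap P (u s) (m s) (ε + l * σ ^ 2 / 2) (L / l) (q.choice act)
          ∂sampleLaw (mmTSLaw P prior ctx act hact t) (ctx t) := by
  set μ := sampleLaw (mmTSLaw P prior ctx act hact t) (ctx t)
  have hfailure : Integrable (fun q => failure P u G σ L l q.2.2 t q.1.2 + ε) μ :=
    (hsubG.integrable_failure_sample hu prior ctx act hact hm.measurableSet L l t).add
      (integrable_const ε)
  have hgap (s : S) : Integrable (fun q => ({s} ×ˢ G).indicator 1 q.2.2 *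
      confidentGap P (u s) (m s) (ε + l * σ ^ 2 / 2) (L / l) (q.choice act)) μ :=
    (hm.integrable_confidentGap (hu s) _ _ s hact μ).bdd_mul (c := 1)
      ((measurable_one.indicator ((measurableSet_singleton s).prod hm.measurableSet)).comp
        measurable_snd.snd).aestronglyMeasurable
      (.of_forall fun q => norm_indicator_one_le_one _ q.2.2)
  refine (integral_mono (integrable_overestimate hosc hact _ (ctx t))
    (hfailure.add (integrable_finsetSum _ fun s _ => hgap s))
    fun q => Draw.overestimate_le hosc act hu hε hm σ L hl q).trans ?_
  simp only [Pi.add_apply]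
  rw [integral_add hfailure (integrable_finsetSum _ fun s _ => hgap s),
    integral_finsetSum _ fun s _ => hgap s, integral_add
      (hsubG.integrable_failure_sample hu prior ctx act hact hm.measurableSet L l t)
      (integrable_const ε), integral_const, probReal_univ, one_smul]
  gcongr
  exact hsubG.integral_failure_sample_le hu prior ctx act hact hm.measurableSet L l t

include hosc hargmax in
theorem integral_roundRegret_le (hsubG : SubgaussianRewards P σ) (hε : 0 ≤ ε) (L : ℝ) {l : ℝ}
    (hl : 0 < l) (t : ℕ) :
    ∫ q, roundRegret P act (q.choice act)
        ∂sampleLaw (mmTSLaw P prior ctx act hact t) (ctx t) ≤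
      prior.snd.real Gᶜ + Fintype.card S * (Real.exp (-L) * (t + 1)) + ε +
        ∑ s, ∫ q, stoppedWeight (stateWeight P prior ctx hact G s) (m s) (ε + l * σ ^ 2 / 2)
            (L / l) t q.1.2 q.2.1 (q.action act) * predictionGap P (m s) (q.choice act)
          ∂sampleLaw (mmTSLaw P prior ctx act hact t) (ctx t) := by
  simp only [← integral_indicator_mul_confidentGap prior ctx hact hm]
  rw [integral_roundRegret_eq hosc hact _ (ctx t) hargmax]
  exact integral_overestimate_le prior ctx hact hm hosc hsubG hε
    (isUnitWeight_stateWeight P prior ctx hact hm.measurableSet) L hl t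

end RegretBound

section TotalExcess

variable {K : ℕ} {X S Θ : Type*} [MeasurableSpace X] [MeasurableSpace S] [MeasurableSpace Θ]
  [StandardBorelSpace S] [StandardBorelSpace Θ] [Nonempty S] [Nonempty Θ]
  {P : Kernel (Fin K × X × S × Θ) ℝ} [IsMarkovKernel P]
  (prior : Measure (S × Θ)) [IsProbabilityMeasure prior]
  (ctx : ∀ t, Kernel (History K X t) X) [∀ t, IsMarkovKernel (ctx t)]
  {act : X → S → Θ → Fin K} (hact : Measurable fun p : X × S × Θ => act p.1 p.2.1 p.2.2)
  {m : S → Fin K → X → ℝ} {G : Set Θ} {ε : ℝ} (hm : IsAccurateOn P m G ε)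

section Excess

variable (s : S) {v : WeightProcess K X} (hv : IsUnitWeight v)

include hm hv

theorem IsAccurateOn.integrable_mul_predictionGap (t : ℕ) :
    Integrable (fun q => v t q.1.2 q.2.1 (q.action act) * predictionGap P (m s) (q.choice act))
      (sampleLaw (mmTSLaw P prior ctx act hact t) (ctx t)) :=
  .of_bound ((hv.measurable_mul_predictionGap (hm.measurable s) t).comp
      (Draw.measurable_choice hact)).aestronglyMeasurable 1
    (.of_forall fun _ => (norm_mul_le _ _).trans (mul_le_one₀
      ((Real.norm_of_nonneg (hv.nonneg ..)).trans_le (hv.le_one ..)) (norm_nonneg _)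
      (hm.abs_sub_le_one ..)))

theorem IsAccurateOn.integrable_excess (n : ℕ) :
    Integrable (fun p => excess P v (m s) p.1 n p.2)
      (mmTSLaw P prior ctx act hact n : Measure ((S × Θ) × History K X n)) :=
  integrable_cumulative P prior ctx act hact
    (hv.measurable_mul_predictionGap (hm.measurable s))
    (hm.integrable_mul_predictionGap prior ctx hact s hv) n

theorem IsAccurateOn.integral_excess_eq (n : ℕ) :
    ∫ p, excess P v (m s) p.1 n p.2
        ∂(mmTSLaw P prior ctx act hact n : Measure ((S × Θ) × History K X n)) =
      ∑ t : Fin n, ∫ q, v t q.1.2 q.2.1 (q.action act) * predictionGap P (m s) (q.choice act)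
        ∂sampleLaw (mmTSLaw P prior ctx act hact t) (ctx t) :=
  integral_cumulative P prior ctx act hact
    (hv.measurable_mul_predictionGap (hm.measurable s))
    (hm.integrable_mul_predictionGap prior ctx hact s hv) n

end Excess

include hm

theorem sum_count_stoppedWeight_le [Fintype S] (c b : ℝ) {n : ℕ} (h : History K X n) :
    ∑ s, count (stoppedWeight (stateWeight P prior ctx hact G s) (m s) c b) n h ≤ n := by
  have hu := isUnitWeight_stateWeight P prior ctx hact hm.measurableSet
  simp only [count, cumulative]
  rw [Finset.sum_comm]
  refine (Finset.sum_le_card_nsmul _ _ 1 fun t _ => ?_).trans_eq (by simp)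
  exact (Finset.sum_le_sum fun s _ => (hu s).stoppedWeight_le ..).trans
    (sum_stateWeight_le_one P prior ctx hact hm.measurableSet ..)

variable [Fintype S] {σ : ℝ≥0}

theorem sum_excess_stoppedWeight_le (hε : 0 ≤ ε) {L l : ℝ} (hL : 0 ≤ L) (hl : 0 < l) {n : ℕ}
    (w : S × Θ) (h : History K X n) :
    ∑ s, excess P (stoppedWeight (stateWeight P prior ctx hact G s) (m s) (ε + l * σ ^ 2 / 2)
        (L / l)) (m s) w n h ≤
      Fintype.card S * (1 + 2 * L / l) + (ε + l * σ ^ 2) * n +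
        Real.exp (-L) / l * ∑ s, expNoiseSum P (stateWeight P prior ctx hact G s) σ l w n h := by
  have hu := isUnitWeight_stateWeight P prior ctx hact hm.measurableSet
  have hc : 0 ≤ ε + l * (σ : ℝ) ^ 2 / 2 := by positivity
  have hcount := mul_le_mul_of_nonneg_left (sum_count_stoppedWeight_le prior ctx hact hm
    (ε + l * σ ^ 2 / 2) (L / l) h) (by positivity : 0 ≤ ε + l * (σ : ℝ) ^ 2)
  have hexcess (s : S) := excess_stoppedWeight_le (hu s) hc (by positivity : 0 ≤ L / l) (σ := σ)
    hL hl (hm.abs_sub_le_one s · · w.1 w.2) h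
  refine (Finset.sum_le_sum fun s _ => hexcess s).trans ?_
  simp only [Finset.sum_add_distrib, ← Finset.mul_sum, Finset.sum_const, Finset.card_univ,
    nsmul_eq_mul]
  linear_combination hcount

theorem sum_integral_excess_le (hsubG : SubgaussianRewards P σ) (hε : 0 ≤ ε) {L l : ℝ}
    (hL : 0 ≤ L) (hl : 0 < l) (n : ℕ) :
    ∑ s, ∫ p, excess P (stoppedWeight (stateWeight P prior ctx hact G s) (m s)
          (ε + l * σ ^ 2 / 2) (L / l)) (m s) p.1 n p.2
        ∂(mmTSLaw P prior ctx act hact n : Measure ((S × Θ) × History K X n)) ≤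
      Fintype.card S * (1 + 2 * L / l) + (ε + l * σ ^ 2) * n +
        Real.exp (-L) / l * (Fintype.card S * (n + 1)) := by
  have hu := isUnitWeight_stateWeight P prior ctx hact hm.measurableSet
  have hexcess (s : S) := hm.integrable_excess prior ctx hact s
    (isUnitWeight_stoppedWeight (hu s) (hm.measurable s) (ε + l * σ ^ 2 / 2) (L / l)) n
  have hnoise (s : S) := hsubG.integrable_expNoiseSum (hu s) prior ctx act hact l n
  rw [← integral_finsetSum _ fun s _ => hexcess s]
  refine (integral_mono (integrable_finsetSum _ fun s _ => hexcess s) ((integrable_const _).add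
    ((integrable_finsetSum _ fun s _ => hnoise s).const_mul _)) fun p =>
    sum_excess_stoppedWeight_le prior ctx hact hm hε hL hl p.1 p.2).trans ?_
  simp only [Pi.add_apply]
  rw [integral_add (integrable_const _)
      ((integrable_finsetSum _ fun s _ => hnoise s).const_mul _),
    integral_const, probReal_univ, one_smul, integral_const_mul,
    integral_finsetSum _ fun s _ => hnoise s, ← Finset.card_univ]
  gcongr
  exact (Finset.sum_le_card_nsmul _ _ _ fun s _ =>
    hsubG.integral_expNoiseSum_le (hu s) prior ctx act hact l n).trans_eq (nsmul_eq_mul _ _)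

end TotalExcess

section MarginalMean

variable {K : ℕ} {X S Θ : Type*} [MeasurableSpace X] [MeasurableSpace S] [MeasurableSpace Θ]
  {P : Kernel (Fin K × X × S × Θ) ℝ}
  (prior : Measure (S × Θ)) [IsProbabilityMeasure prior] (hosc : UnitOscillation P)

include hosc

theorem abs_marginalMean_sub_le (a : Fin K) (x : X) (s s' : S) (θ' : Θ) :
    |marginalMean P prior a x s - meanReward P a x s' θ'| ≤ 1 := by
  have hdiff : Integrable (fun θ => meanReward P a x s θ - meanReward P a x s' θ') prior.snd :=
    .of_bound (by fun_prop) 1 (.of_forall fun θ => hosc ..)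
  have hmean : Integrable (fun θ => meanReward P a x s θ) prior.snd :=
    (hdiff.add (integrable_const (meanReward P a x s' θ'))).congr
      (.of_forall fun θ => sub_add_cancel ..)
  have hsub : marginalMean P prior a x s - meanReward P a x s' θ' =
      ∫ θ, (meanReward P a x s θ - meanReward P a x s' θ') ∂prior.snd := by
    rw [integral_sub hmean (integrable_const _), integral_const, probReal_univ, one_smul,
      marginalMean]
  rw [hsub]
  simpa only [Real.norm_eq_abs, probReal_univ, mul_one] using
    norm_integral_le_of_norm_le_const (μ := prior.snd) (C := 1)
      (f := fun θ => meanReward P a x s θ - meanReward P a x s' θ') (.of_forall fun _ => hosc ..)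

theorem isAccurateOn_marginalMean {G : Set Θ} {ε : ℝ} (hG : MeasurableSet G)
    (hGε : ∀ θ ∈ G, ∀ a x s, |marginalMean P prior a x s - meanReward P a x s θ| ≤ ε) :
    IsAccurateOn P (fun s a x => marginalMean P prior a x s) G ε where
  measurable s := (measurable_marginalMean P prior).comp
    (by fun_prop : Measurable fun p : Fin K × X => (p.1, p.2, s))
  measurableSet := hG
  abs_sub_le θ hθ s a x := hGε θ hθ a x s
  abs_sub_le_one s a x s' θ := abs_marginalMean_sub_le prior hosc a x s s' θ

end MarginalMean

theorem exists_pos_mul_add_div_le {A B c : ℝ} (hA : 0 ≤ A) (hB : 0 < B) (hc : 0 < c) :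
    ∃ l > 0, l * A + B / l ≤ c + 2 * √(A * B) := by
  rcases hA.eq_or_lt with rfl | hA
  · exact ⟨B / c, by positivity, by simp [div_div_cancel₀ hB.ne']⟩
  · refine ⟨√B / √A, by positivity, ?_⟩
    have hleft : √B / √A * A = √A * √B := by
      rw [div_mul_comm, Real.div_sqrt]
    have hright : B / (√B / √A) = √A * √B := by
      rw [div_div_eq_mul_div, mul_div_right_comm, Real.div_sqrt, mul_comm]
    rw [Real.sqrt_mul hA.le, hleft, hright]
    linarith

section BayesRegret

variable {K : ℕ} {X S Θ : Type*} [MeasurableSpace X] [MeasurableSpace S] [MeasurableSpace Θ]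
  [StandardBorelSpace S] [StandardBorelSpace Θ] [Nonempty S] [Nonempty Θ]
  {P : Kernel (Fin K × X × S × Θ) ℝ} [IsMarkovKernel P]
  (prior : Measure (S × Θ)) [IsProbabilityMeasure prior]
  (ctx : ∀ t, Kernel (History K X t) X) [∀ t, IsMarkovKernel (ctx t)]
  {act : X → S → Θ → Fin K} (hact : Measurable fun p : X × S × Θ => act p.1 p.2.1 p.2.2)
  (hosc : UnitOscillation P) (hargmax : IsArgmax P act)

include hosc hargmax

theorem integrable_regret (n : ℕ) :
    Integrable (regret P act n)
      (mmTSLaw P prior ctx act hact n : Measure ((S × Θ) × History K X n)) :=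
  integrable_cumulative P prior ctx act hact (fun _ => measurable_roundRegret hact)
    (fun t => integrable_roundRegret hosc hact _ (ctx t) hargmax) n

theorem bayesRegret_eq_sum (n : ℕ) :
    bayesRegret P prior ctx act hact n =
      ∑ t : Fin n, ∫ q, roundRegret P act (q.choice act)
        ∂sampleLaw (mmTSLaw P prior ctx act hact t) (ctx t) :=
  integral_cumulative P prior ctx act hact (fun _ => measurable_roundRegret hact)
    (fun t => integrable_roundRegret hosc hact _ (ctx t) hargmax) n

theorem bayesRegret_le_natCast (n : ℕ) : bayesRegret P prior ctx act hact n ≤ n := by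
  rw [bayesRegret_eq_sum prior ctx hact hosc hargmax]
  refine (Finset.sum_le_card_nsmul _ _ 1 fun t _ => ?_).trans_eq (by simp)
  rw [integral_roundRegret_eq hosc hact _ (ctx t) hargmax]
  refine (integral_mono (integrable_overestimate hosc hact _ (ctx t)) (integrable_const 1)
    fun q => (le_abs_self _).trans (hosc ..)).trans_eq ?_
  rw [integral_const, probReal_univ, one_smul]

variable [Fintype S] {σ : ℝ≥0} (hsubG : SubgaussianRewards P σ)
  {m : S → Fin K → X → ℝ} {G : Set Θ} {ε : ℝ} (hm : IsAccurateOn P m G ε) (hε : 0 ≤ ε)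

include hsubG hm hε

theorem bayesRegret_le_of_param {L l : ℝ} (hL : 0 ≤ L) (hl : 0 < l) (n : ℕ) :
    bayesRegret P prior ctx act hact n ≤
      n * (prior.snd.real Gᶜ + Fintype.card S * (Real.exp (-L) * n) + ε) +
        (Fintype.card S * (1 + 2 * L / l) + (ε + l * σ ^ 2) * n +
          Real.exp (-L) / l * (Fintype.card S * (n + 1))) := by
  let u := stateWeight P prior ctx hact G
  let v s := stoppedWeight (u s) (m s) (ε + l * σ ^ 2 / 2) (L / l)
  have hu (s : S) : IsUnitWeight (u s) :=
    isUnitWeight_stateWeight P prior ctx hact hm.measurableSet s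
  have hv (s : S) : IsUnitWeight (v s) := isUnitWeight_stoppedWeight (hu s) (hm.measurable s) _ _
  calc bayesRegret P prior ctx act hact n
      ≤ ∑ t : Fin n, (prior.snd.real Gᶜ + Fintype.card S * (Real.exp (-L) * n) + ε +
          ∑ s, ∫ q, v s t q.1.2 q.2.1 (q.action act) * predictionGap P (m s) (q.choice act)
            ∂sampleLaw (mmTSLaw P prior ctx act hact t) (ctx t)) := by
        rw [bayesRegret_eq_sum prior ctx hact hosc hargmax]
        refine Finset.sum_le_sum fun t _ => (integral_roundRegret_le prior ctx hact hm hosc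
          hargmax hsubG hε L hl t).trans ?_
        have ht : (t : ℝ) + 1 ≤ n := by exact_mod_cast t.2
        gcongr
    _ = n * (prior.snd.real Gᶜ + Fintype.card S * (Real.exp (-L) * n) + ε) +
          ∑ s, ∫ p, excess P (v s) (m s) p.1 n p.2
            ∂(mmTSLaw P prior ctx act hact n : Measure ((S × Θ) × History K X n)) := by
        simp only [Finset.sum_add_distrib, Finset.sum_const, Finset.card_univ, Fintype.card_fin,
          nsmul_eq_mul, hm.integral_excess_eq prior ctx hact _ (hv _)]
        rw [Finset.sum_comm]
        ring
    _ ≤ _ := by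
        gcongr
        exact sum_integral_excess_le prior ctx hact hm hsubG hε hL hl n

theorem bayesRegret_le_of_two_le {n : ℕ} (hn : 2 ≤ n) :
    bayesRegret P prior ctx act hact n ≤
      n * prior.snd.real Gᶜ + 3 * (Fintype.card S : ℝ) + 2 * n * ε +
        2 * σ * √(6 * (Fintype.card S : ℝ) * n * Real.log n) := by
  have hcard : (1 : ℝ) ≤ Fintype.card S := by exact_mod_cast Fintype.card_pos (α := S)
  have hn : (2 : ℝ) ≤ n := by exact_mod_cast hn
  have hlog : 1 ≤ 2 * Real.log n := by
    linarith [Real.log_two_gt_d9, Real.log_le_log two_pos hn]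
  obtain ⟨l, hl, hopt⟩ := exists_pos_mul_add_div_le (A := σ ^ 2 * n)
    (B := Fintype.card S * (6 * Real.log n)) (c := Fintype.card S) (by positivity)
    (mul_pos (by linarith) (by linarith)) (by linarith)
  have hsqrt : √(σ ^ 2 * n * (Fintype.card S * (6 * Real.log n))) =
      σ * √(6 * (Fintype.card S : ℝ) * n * Real.log n) := by
    rw [mul_assoc, Real.sqrt_mul (sq_nonneg _), Real.sqrt_sq σ.coe_nonneg]
    ring_nf
  have hexp : n * n * Real.exp (-(2 * Real.log n)) = 1 := by
    rw [two_mul, neg_add, Real.exp_add, Real.exp_neg, Real.exp_log (by linarith)]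
    field_simp
  have hlogs : 4 * Real.log n + (n + 1) * Real.exp (-(2 * Real.log n)) ≤ 6 * Real.log n := by
    have hsq : (n + 1) * Real.exp (-(2 * Real.log n)) ≤ 1 := hexp ▸ by gcongr; nlinarith
    linarith
  calc bayesRegret P prior ctx act hact n
      ≤ _ := bayesRegret_le_of_param prior ctx hact hosc hargmax hsubG hm hε
        (by linarith : 0 ≤ 2 * Real.log n) hl n
    _ = n * prior.snd.real Gᶜ + 2 * n * ε + Fintype.card S * (n * n *
          Real.exp (-(2 * Real.log n))) + Fintype.card S + (l * (σ ^ 2 * n) + Fintype.card S *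
          (4 * Real.log n + (n + 1) * Real.exp (-(2 * Real.log n))) / l) := by ring
    _ ≤ n * prior.snd.real Gᶜ + 2 * n * ε + Fintype.card S * 1 + Fintype.card S +
          (l * (σ ^ 2 * n) + Fintype.card S * (6 * Real.log n) / l) := by
        rw [hexp]
        gcongr
    _ ≤ _ := by
        rw [hsqrt] at hopt
        linarith

theorem bayesRegret_le (n : ℕ) :
    bayesRegret P prior ctx act hact n ≤
      n * prior.snd.real Gᶜ + 3 * (Fintype.card S : ℝ) + 2 * n * ε +
        2 * σ * √(6 * (Fintype.card S : ℝ) * n * Real.log n) := by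
  rcases lt_or_ge n 2 with hn | hn
  · have hcard : (1 : ℝ) ≤ Fintype.card S := by exact_mod_cast Fintype.card_pos (α := S)
    have hn : (n : ℝ) ≤ 1 := by exact_mod_cast Nat.lt_succ_iff.1 hn
    have hrest : 0 ≤ n * prior.snd.real Gᶜ + 2 * n * ε +
      2 * σ * √(6 * (Fintype.card S : ℝ) * n * Real.log n) := by positivity
    linarith [bayesRegret_le_natCast prior ctx hact hosc hargmax n]
  · exact bayesRegret_le_of_two_le prior ctx hact hosc hargmax hsubG hm hε hn

end BayesRegret

end LatentBandit

theorem corollary2_general {K : ℕ} {X S Θ : Type*} [MeasurableSpace X]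
    [Fintype S] [Nonempty S] [MeasurableSpace S] [MeasurableSingletonClass S]
    [MeasurableSpace Θ] [StandardBorelSpace Θ] [Nonempty Θ]
    (P : Kernel (Fin K × X × S × Θ) ℝ) [IsMarkovKernel P]
    (prior : Measure (S × Θ)) [IsProbabilityMeasure prior]
    (ctx : ∀ t, Kernel (LatentBandit.History K X t) X) [∀ t, IsMarkovKernel (ctx t)]
    (act : X → S → Θ → Fin K) (hact : Measurable fun p : X × S × Θ => act p.1 p.2.1 p.2.2)
    (hargmax : LatentBandit.IsArgmax P act)
    (σ : ℝ≥0)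
    (hsubG : ∀ a x s θ,
      HasSubgaussianMGF (fun r => r - LatentBandit.meanReward P a x s θ) (σ ^ 2) (P (a, x, s, θ)))
    (hosc : ∀ a x s s' θ θ',
      |LatentBandit.meanReward P a x s θ - LatentBandit.meanReward P a x s' θ'| ≤ 1)
    (ε δ : ℝ) (hε : 0 ≤ ε)
    (hmeas : NullMeasurableSet
      {θ | ∀ a x s, |LatentBandit.marginalMean P prior a x s -
        LatentBandit.meanReward P a x s θ| ≤ ε} prior.snd)
    (hclose : 1 - δ ≤ prior.snd.real
      {θ | ∀ a x s, |LatentBandit.marginalMean P prior a x s -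
        LatentBandit.meanReward P a x s θ| ≤ ε})
    (n : ℕ) :
    Integrable (LatentBandit.regret P act n)
        (LatentBandit.mmTSLaw P prior ctx act hact n :
          Measure ((S × Θ) × LatentBandit.History K X n)) ∧
      LatentBandit.bayesRegret P prior ctx act hact n ≤
        n * δ + 3 * (Fintype.card S : ℝ) + 2 * n * ε +
          2 * σ * √(6 * (Fintype.card S : ℝ) * n * Real.log n) := by
  obtain ⟨G, hGs, hG, hGae⟩ := hmeas.exists_measurable_subset_ae_eq
  have hGδ : prior.snd.real Gᶜ ≤ δ := by
    rw [probReal_compl_eq_one_sub hG, measureReal_congr hGae]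
    linarith
  have haccurate := LatentBandit.isAccurateOn_marginalMean prior hosc hG fun θ hθ => hGs hθ
  refine ⟨LatentBandit.integrable_regret prior ctx hact hosc hargmax n,
    (LatentBandit.bayesRegret_le prior ctx hact hosc hargmax hsubG haccurate hε n).trans ?_⟩
  gcongr

theorem corollary2 {K : ℕ} {X S Θ : Type*} [MeasurableSpace X]
    [Fintype S] [Nonempty S] [MeasurableSpace S] [MeasurableSingletonClass S]
    [MeasurableSpace Θ] [StandardBorelSpace Θ] [Nonempty Θ]
    (P : Kernel (Fin K × X × S × Θ) ℝ) [IsMarkovKernel P]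
    (prior : Measure (S × Θ)) [IsProbabilityMeasure prior]
    (ctx : ∀ t, Kernel (LatentBandit.History K X t) X) [∀ t, IsMarkovKernel (ctx t)]
    (act : X → S → Θ → Fin K) (hact : Measurable fun p : X × S × Θ => act p.1 p.2.1 p.2.2)
    (hargmax : LatentBandit.IsArgmax P act)
    (σ : ℝ≥0)
    (hsubG : ∀ a x s θ,
      HasSubgaussianMGF (fun r => r - LatentBandit.meanReward P a x s θ) (σ ^ 2) (P (a, x, s, θ)))
    (hsubopt : ∀ a a' x s θ,
      LatentBandit.meanReward P a' x s θ - LatentBandit.meanReward P a x s θ ≤ 1)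
    (hosc : ∀ a x s s' θ θ',
      |LatentBandit.meanReward P a x s θ - LatentBandit.meanReward P a x s' θ'| ≤ 1)
    (ε δ : ℝ) (hε : 0 < ε) (hδ : 0 < δ)
    (hmeas : NullMeasurableSet
      {θ | ∀ a x s, |LatentBandit.marginalMean P prior a x s -
        LatentBandit.meanReward P a x s θ| ≤ ε} prior.snd)
    (hclose : 1 - δ ≤ prior.snd.real
      {θ | ∀ a x s, |LatentBandit.marginalMean P prior a x s -
        LatentBandit.meanReward P a x s θ| ≤ ε})
    (n : ℕ) :
    Integrable (LatentBandit.regret P act n)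
        (LatentBandit.mmTSLaw P prior ctx act hact n :
          Measure ((S × Θ) × LatentBandit.History K X n)) ∧
      LatentBandit.bayesRegret P prior ctx act hact n ≤
        n * δ + 3 * (Fintype.card S : ℝ) + 2 * n * ε +
          2 * σ * √(6 * (Fintype.card S : ℝ) * n * Real.log n) :=
  corollary2_general P prior ctx act hact hargmax σ hsubG hosc ε δ hε.le hmeas hclose n
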